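/- Consider the 2-choices dynamics with node-failure probability $\alpha$ on the complete graph with $n$ nodes. Each node holds an opinion in $\{0,1\}$ and updates at the points of an independent unit rate Poisson process. At an update, with probability $\alpha$ the node fails and adopts one of the two opinions uniformly at random; with probability $1-\alpha$ it samples two of its neighbours uniformly at random with replacement, adopts their common opinion if they agree, and keeps its opinion otherwise. Let $X(t)\in\{0,1\}^n$ be the vector of opinions at time $t$, let $A(t)$ be the number of nodes holding opinion $1$, and let $T_{1/2}=\inf\{t\ge 0: A(t)=\lceil n/2\rceil \text{ or } A(t)=\lfloor n/2\rfloor\}$. Let $\pi$ be the unique equilibrium distribution of $X$, let $d(t)=\max_{x}\max_{\Gamma}|\mathbb P_x(X(t)\in\Gamma)-\pi(\Gamma)|$, and let $t_{\mathrm{mix}}=\inf\{t\ge 0: d(t)\le 1/4\}$; the mixing time of the Markov chain $A$ is defined in the same way. 1. Let $0<\alpha<1/3$. Then $t_{\mathrm{mix}}=\Omega(\exp(\Theta(n)))$, that is, there are constants $\kappa,C>0$ depending only on $\alpha$ such that $t_{\mathrm{mix}}\ge C\exp(\kappa n)$ for all sufficiently large $n$. Moreover, for every $p\in[0,1]$ with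 $p\ne 1/2$, given that $A(0)=\lceil np\rceil$, we have $T_{1/2}=\Omega(\exp(\Theta(n)))$ with high probability, that is, there are constants $\kappa,C>0$ depending only on $\alpha$ and $p$ such that $\mathbb P(T_{1/2}\ge C\exp(\kappa n)\mid A(0)=\lceil np\rceil)\to 1$ as $n\to\infty$. 2. Let $1/3<\alpha\le 1$. Then $t_{\mathrm{mix}}=O(\log n)$, and $\mathbb E_a[T_{1/2}]=O(\log n)$ uniformly over all $a\in\{0,1,\ldots,n\}$, where $\mathbb E_a$ denotes expectation given $A(0)=a$; the implied constants depend only on $\alpha$. The bounds on the mixing time hold both for $X$ and for $A$. -/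

import Mathlib

open Filter Topology MeasureTheory ProbabilityTheory
open scoped ENNReal NNReal

namespace TwoChoices

/-- A configuration of opinions (`true` is opinion `1`, `false` is opinion `0`). -/
abbrev State (V : Type*) := V → Bool

/-- `A(x)`: the number of nodes holding opinion `1` in the configuration `x`. -/
def countOnes {V : Type*} [Fintype V] (x : State V) : ℕ :=
  (Finset.univ.filter (fun v => x v = true)).card

/-- All the randomness used by one update: the updating node, whether that node fails, the fair
opinion it adopts if it fails, and the two neighbours it samples if it does not fail. -/
structure Update (V : Type*) where
  node : V
  fails : Bool
  coin : Bool
  nbr₁ : V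
  nbr₂ : V

instance (V : Type*) : MeasurableSpace (Update V) := ⊤

instance (V : Type*) : DiscreteMeasurableSpace (Update V) := ⟨fun _ => trivial⟩

/-- The effect of one update. A failing node adopts the fair opinion; a node that does not fail
adopts the common opinion of the two sampled neighbours if they agree and otherwise keeps its
opinion. -/
def Update.apply {V : Type*} [DecidableEq V] (e : Update V) (x : State V) : State V :=
  if e.fails = true then Function.update x e.node e.coin
  else if x e.nbr₁ = x e.nbr₂ then Function.update x e.node (x e.nbr₁)
  else x

noncomputable section

/-- The failure indicator: `true` with probability `α`. -/
def failureLaw (α : unitInterval) : PMF Bool :=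
  PMF.ofFintype (fun b => if b = true then ENNReal.ofReal α else ENNReal.ofReal (1 - α)) (by
    have h0 : (0 : ℝ) ≤ α := α.2.1
    have h1 : (0 : ℝ) ≤ 1 - α := by linarith [α.2.2]
    simp [← ENNReal.ofReal_add h0 h1])

/-- A uniformly random neighbour of `v`. (An isolated node, which does not occur in a connected
graph with at least two nodes, samples itself.) -/
def neighbourLaw {V : Type*} [Fintype V] (G : SimpleGraph V) [DecidableRel G.Adj] (v : V) :
    PMF V :=
  if h : (G.neighborFinset v).Nonempty then PMF.uniformOfFinset (G.neighborFinset v) h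
  else PMF.pure v

/-- The law of the randomness of one update: a uniform node, an independent failure indicator, an
independent fair opinion, and two independent uniform neighbours of the node (with replacement). -/
def updateLaw {V : Type*} [Fintype V] [Nonempty V] (G : SimpleGraph V) [DecidableRel G.Adj]
    (α : unitInterval) : PMF (Update V) :=
  (PMF.uniformOfFintype V).bind fun v =>
  (failureLaw α).bind fun f =>
  (PMF.uniformOfFintype Bool).bind fun b =>
  (neighbourLaw G v).bind fun u =>
  (neighbourLaw G v).bind fun w =>
  PMF.pure ⟨v, f, b, u, w⟩

/-- The probability space: for every `k`, the waiting time between the `k`-th and the `(k+1)`-st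
update in the network, together with the randomness used by the `(k+1)`-st update. -/
abbrev Randomness (V : Type*) := ℕ → ℝ × Update V

/-- The driving randomness. The updates of `n` nodes with independent unit rate Poisson clocks
form a Poisson process of rate `n` (independent exponential waiting times of rate `n`), each of
its points belonging to an independent uniform node. -/
def driving {V : Type*} [Fintype V] [Nonempty V] (G : SimpleGraph V) [DecidableRel G.Adj]
    (α : unitInterval) : Measure (Randomness V) :=
  Measure.infinitePi fun _ : ℕ =>
    (expMeasure (Fintype.card V : ℝ)).prod (updateLaw G α).toMeasure

/-- The time of the `k`-th update (`0` for `k = 0`). -/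
def updateTime {V : Type*} (ω : Randomness V) (k : ℕ) : ℝ :=
  ∑ i ∈ Finset.range k, (ω i).1

/-- The configuration after `k` updates, started from `x`. -/
def stateAfter {V : Type*} [DecidableEq V] (x : State V) (ω : Randomness V) : ℕ → State V
  | 0 => x
  | k + 1 => (ω k).2.apply (stateAfter x ω k)

/-- `X(t)` started from `X(0) = x`: the configuration after the last update up to time `t`. -/
def dynamics {V : Type*} [DecidableEq V] (x : State V) (ω : Randomness V) (t : ℝ≥0) : State V :=
  stateAfter x ω (sInf {k : ℕ | (t : ℝ) < updateTime ω (k + 1)})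

/-- `T_p`: the first time at which the number of nodes with opinion `1` is `⌈pn⌉` or `⌊pn⌋`
(`∞` if there is no such time), for the dynamics started from `x`. -/
def hittingTime {V : Type*} [Fintype V] [DecidableEq V] (p : ℝ) (x : State V)
    (ω : Randomness V) : ℝ≥0∞ :=
  ⨅ (t : ℝ≥0) (_ : countOnes (dynamics x ω t) = ⌈p * Fintype.card V⌉₊ ∨
    countOnes (dynamics x ω t) = ⌊p * Fintype.card V⌋₊), (t : ℝ≥0∞)

/-- `π` is an equilibrium (stationary) distribution of the dynamics: if `X(0)` has law `π`, then
so has `X(t)`, for every `t`. -/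
def IsStationary {V : Type*} [Fintype V] [Nonempty V] [DecidableEq V] (G : SimpleGraph V)
    [DecidableRel G.Adj] (α : unitInterval) (π : PMF (State V)) : Prop :=
  ∀ (t : ℝ≥0) (y : State V), ∑ x, π x * driving G α {ω | dynamics x ω t = y} = π y

/-- The equilibrium distribution of the dynamics (it exists, and is unique if `0 < α`). -/
def equilibrium {V : Type*} [Fintype V] [Nonempty V] [DecidableEq V] (G : SimpleGraph V)
    [DecidableRel G.Adj] (α : unitInterval) : PMF (State V) :=
  Classical.epsilon (IsStationary G α)

/-- For a function `f` of the configuration, the largest total variation distance, over all initial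
configurations, between the law of `f(X(t))` and the law of `f` in equilibrium. For `f = id` this
is `d(t)` for the process `X`; for `f = countOnes` on a complete graph it is `d(t)` for the
birth-death chain `A(X(t))`. -/
def distToEquilibrium {V : Type*} [Fintype V] [Nonempty V] [DecidableEq V] (G : SimpleGraph V)
    [DecidableRel G.Adj] (α : unitInterval) {β : Type*} (f : State V → β) (t : ℝ≥0) : ℝ :=
  ⨆ (x : State V) (Γ : Set β),
    |(driving G α).real {ω | f (dynamics x ω t) ∈ Γ} - (equilibrium G α).toMeasure.real (f ⁻¹' Γ)|

/-- The mixing time `t_mix = inf {t ≥ 0 : d(t) ≤ 1/4}` of `f(X(t))` (`∞` if there is no such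
time). -/
def mixingTime {V : Type*} [Fintype V] [Nonempty V] [DecidableEq V] (G : SimpleGraph V)
    [DecidableRel G.Adj] (α : unitInterval) {β : Type*} (f : State V → β) : ℝ≥0∞ :=
  ⨅ (t : ℝ≥0) (_ : distToEquilibrium G α f t ≤ 1 / 4), (t : ℝ≥0∞)

/-- The complete graph on `n` nodes. -/
abbrev K (n : ℕ+) : SimpleGraph (Fin n) := ⊤

end

end TwoChoices

open TwoChoices

namespace TwoChoices

/-! Observed at update times, the number `h` of nodes with a given opinion is a birth-death chain
(`transOp_count`). Its down-probability minus its up-probability is `(2h - n)/n * (α/2 - (1-α)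
h(n-h)/(n-1)^2)` (`upProb_sub_upProb`). Near `h = n/2` the last factor is about `(3α-1)/4`, so the
balanced state turns from repelling to attracting as `α` passes `1/3`. The estimates are made for
the discrete recursion; the Poisson clock is independent of the updates and enters only through tail
bounds for the number of updates by a given time.

Below `1/3`, a minority opinion is pushed down in the band from `(1/2-2δ)n` to `(1/2-δ)n`. There an
exponential of `h` is a supermartingale; below the band its drift is bounded (`exp_drift_le`), while
at the top of the band it is exponentially large. A maximal inequality then forbids crossing the
band for exponentially many updates (`exists_earlyEntrance_le`). This bounds the hitting time of
`n/2` from below. It also keeps the laws started from the two consensus states almost disjoint, so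
both cannot be close to the same distribution (`le_mixingTime`).

Above `1/3`, mixing follows from path coupling: two configurations that differ at one node and share
an update differ afterwards at fewer than one node on average, by a margin of order `1/n`
(`integral_discrepancy_le`). In dual form the transition operator contracts Lipschitz constants, so
order `n log n` updates suffice; the same contraction produces an equilibrium (`exists_invariant`).
For the hitting time, `log (1 + |2h-n|/√n)` has drift at most a negative constant over `n`
(`lyapunov_drift_le`): the restoring drift gives this far from balance, the fluctuations close to
it. Its initial value is at most `log n` for large `n`, and updates come at rate `n`. -/

theorem measurePreserving_zip {A B : Type*} [MeasurableSpace A] [MeasurableSpace B]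
    (μ : Measure A) (ν : Measure B) [IsProbabilityMeasure μ] [IsProbabilityMeasure ν] :
    MeasurePreserving (fun (p : (ℕ → A) × (ℕ → B)) (i : ℕ) => (p.1 i, p.2 i))
      ((Measure.infinitePi fun _ : ℕ => μ).prod (Measure.infinitePi fun _ : ℕ => ν))
      (Measure.infinitePi fun _ : ℕ => μ.prod ν) := by
  have hm : Measurable (fun (p : (ℕ → A) × (ℕ → B)) (i : ℕ) => (p.1 i, p.2 i)) := by fun_prop
  refine ⟨hm, ?_⟩
  refine IsProjectiveLimit.unique (P := fun I : Finset ℕ => Measure.pi fun _ : I => μ.prod ν)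
    (fun I => ?_) (fun I => Measure.infinitePi_map_restrict _)
  have hI := (measurePreserving_arrowProdEquivProdArrow A B I (fun _ => μ) (fun _ => ν)).symm
  rw [Measure.map_map (by fun_prop) hm]
  refine Eq.trans ?_ hI.map_eq
  rw [← Measure.infinitePi_map_restrict (μ := fun _ : ℕ => μ) (I := I),
    ← Measure.infinitePi_map_restrict (μ := fun _ : ℕ => ν) (I := I),
    Measure.map_prod_map _ _ (by fun_prop) (by fun_prop),
    Measure.map_map hI.measurable (by fun_prop)]
  rfl

/-! ### Random recursions with independent inputs, and drift inequalities -/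

/-- The random recursion `X (k + 1) = a (u k) (X k)` started from `x`. -/
def chain {U S : Type*} (a : U → S → S) (x : S) (u : ℕ → U) : ℕ → S
  | 0 => x
  | k + 1 => a (u k) (chain a x u k)

theorem chain_congr {U S : Type*} (a : U → S → S) (x : S) {u u' : ℕ → U} {k : ℕ}
    (h : ∀ i < k, u i = u' i) : chain a x u k = chain a x u' k := by
  induction k with
  | zero => rfl
  | succ k ih =>
    simp only [chain]
    rw [h k (by omega), ih fun i hi => h i (by omega)]

open Classical in
/-- The recursion stopped on entering `Z`. -/
noncomputable def absorb {U S : Type*} (Z : Set S) (a : U → S → S) (e : U) (s : S) : S :=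
  if s ∈ Z then s else a e s

/-- Absorption turns a statement about the whole path up to `k` into one about a single state, to
which the transition operator applies. -/
theorem chain_absorb_mem {U S : Type*} (Z : Set S) (a : U → S → S) (x : S) (u : ℕ → U) (k : ℕ) :
    (chain (absorb Z a) x u k ∈ Z ∧ ∃ j ≤ k, chain a x u j ∈ Z) ∨
      (chain (absorb Z a) x u k ∉ Z ∧ chain (absorb Z a) x u k = chain a x u k ∧
        ∀ j ≤ k, chain a x u j ∉ Z) := by
  induction k with
  | zero =>
    by_cases h : x ∈ Z
    · exact .inl ⟨h, 0, le_rfl, h⟩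
    · refine .inr ⟨h, rfl, fun j hj => ?_⟩
      obtain rfl : j = 0 := by omega
      exact h
  | succ k ih =>
    rcases ih with ⟨h, j, hj, hj'⟩ | ⟨h, he, hall⟩
    · refine .inl ⟨?_, j, by omega, hj'⟩
      simp only [chain, absorb, h, if_true]
    · have h1 : chain (absorb Z a) x u (k + 1) = chain a x u (k + 1) := by
        simp only [chain, absorb, h, if_false]
        rw [he]
      by_cases hZ : chain a x u (k + 1) ∈ Z
      · exact .inl ⟨h1 ▸ hZ, k + 1, le_rfl, hZ⟩
      · refine .inr ⟨h1 ▸ hZ, h1, fun j hj => ?_⟩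
        rcases Nat.lt_or_ge j (k + 1) with h' | h'
        · exact hall j (by omega)
        · obtain rfl : j = k + 1 := by omega
          exact hZ

section Chain

variable {U S : Type*} [MeasurableSpace U] [DiscreteMeasurableSpace U] [Finite U]
  [MeasurableSpace S] [DiscreteMeasurableSpace S] [Finite S]

/-- The transition operator of the recursion with independent inputs of law `ν`. -/
noncomputable def stepOp (ν : Measure U) (a : U → S → S) (f : S → ℝ) (x : S) : ℝ :=
  ∫ e, f (a e x) ∂ν

theorem measurable_chain (a : U → S → S) (x : S) (k : ℕ) :
    Measurable fun u => chain a x u k := by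
  induction k with
  | zero => exact measurable_const
  | succ k ih =>
    have h : Measurable fun p : U × S => a p.1 p.2 := measurable_of_countable _
    exact h.comp ((measurable_pi_apply k).prodMk ih)

/-- The state at `k` is a function of the inputs before `k` only; `ext` fills in the later inputs
with an arbitrary value. -/
theorem indepFun_chain (ν : Measure U) [IsProbabilityMeasure ν] (a : U → S → S) (x : S) (k : ℕ) :
    IndepFun (fun u => chain a x u k) (fun u : ℕ → U => u k)
      (Measure.infinitePi fun _ : ℕ => ν) := by
  have hU : Nonempty U := nonempty_of_isProbabilityMeasure ν
  let e0 := hU.some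
  have hind : iIndepFun (fun (i : ℕ) (u : ℕ → U) => u i) (Measure.infinitePi fun _ : ℕ => ν) :=
    iIndepFun_infinitePi (X := fun _ => id) (fun _ => measurable_id)
  have h := hind.indepFun_finset (Finset.range k) {k} (by simp) (fun i => measurable_pi_apply i)
  let ext : ((i : Finset.range k) → U) → ℕ → U := fun v i => if h : i ∈ Finset.range k then v ⟨i, h⟩ else e0
  have hext : Measurable ext := by
    refine measurable_pi_lambda _ fun i => ?_
    by_cases h : i ∈ Finset.range k
    · simp only [ext, h, dif_pos]
      exact measurable_pi_apply (⟨i, h⟩ : Finset.range k)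
    · simp only [ext, h, dif_neg, not_false_iff]
      exact measurable_const
  have h2 := h.comp ((measurable_chain a x k).comp hext)
    (measurable_pi_apply (⟨k, by simp⟩ : ({k} : Finset ℕ)))
  have h3 : (fun u : ℕ → U => chain a x u k) = ((fun u => chain a x u k) ∘ ext) ∘
      fun (u : ℕ → U) (i : Finset.range k) => u i := by
    funext u
    refine chain_congr a x fun i hi => ?_
    simp [ext, hi]
  rw [h3]
  exact h2

variable (ν : Measure U) [IsProbabilityMeasure ν] (a : U → S → S) (x : S)

theorem integrable_chain (f : S → ℝ) (k : ℕ) :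
    Integrable (fun u => f (chain a x u k)) (Measure.infinitePi fun _ : ℕ => ν) := by
  have : Integrable f ((Measure.infinitePi fun _ : ℕ => ν).map fun u => chain a x u k) :=
    have := Measure.isProbabilityMeasure_map (μ := Measure.infinitePi fun _ : ℕ => ν)
      (measurable_chain (U := U) a x k).aemeasurable
    .of_finite
  exact this.comp_measurable (measurable_chain a x k)

omit [IsProbabilityMeasure ν] in
theorem integral_indicator_chain (Z : Set S) (M : ℝ) (k : ℕ) :
    ∫ u, Z.indicator (fun _ => M) (chain a x u k) ∂(Measure.infinitePi fun _ : ℕ => ν) =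
      (Measure.infinitePi fun _ : ℕ => ν).real {u | chain a x u k ∈ Z} * M := by
  have h := integral_indicator_const (μ := Measure.infinitePi fun _ : ℕ => ν) M
    (measurable_chain a x k (.of_discrete (s := Z)))
  rw [smul_eq_mul] at h
  exact h

theorem integral_chain_succ (f : S → ℝ) (k : ℕ) :
    ∫ u, f (chain a x u (k + 1)) ∂(Measure.infinitePi fun _ : ℕ => ν) =
      ∫ u, stepOp ν a f (chain a x u k) ∂(Measure.infinitePi fun _ : ℕ => ν) := by
  have hm := measurable_chain (U := U) a x k
  have hprob := Measure.isProbabilityMeasure_map (μ := Measure.infinitePi fun _ : ℕ => ν)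
      hm.aemeasurable
  have h := (indepFun_iff_map_prod_eq_prod_map_map hm.aemeasurable
    (measurable_pi_apply k).aemeasurable).1 (indepFun_chain ν a x k)
  rw [Measure.infinitePi_map_eval] at h
  have hF : Measurable fun p : S × U => f (a p.2 p.1) := measurable_of_countable _
  calc _ = ∫ u, (fun p : S × U => f (a p.2 p.1)) (chain a x u k, u k)
        ∂(Measure.infinitePi fun _ : ℕ => ν) := rfl
    _ = _ := by
      rw [← integral_map (φ := fun u : ℕ → U => (chain a x u k, u k))
        (hm.prodMk (measurable_pi_apply k)).aemeasurable hF.aestronglyMeasurable, h,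
        integral_prod _ .of_finite,
        integral_map hm.aemeasurable (measurable_of_countable _).aestronglyMeasurable]
      rfl

theorem integral_chain (f : S → ℝ) (k : ℕ) :
    ∫ u, f (chain a x u k) ∂(Measure.infinitePi fun _ : ℕ => ν) = ((stepOp ν a)^[k] f) x := by
  induction k generalizing f with
  | zero => simp [chain]
  | succ k ih => rw [integral_chain_succ, ih, Function.iterate_succ_apply]

/-- A discrete Dynkin inequality, obtained by summing the one-step drift. The bounds on expected
entrance times and the maximal inequality are both instances for the absorbed recursion. -/
theorem integral_chain_le_of_stepOp_le (f g : S → ℝ) (h : ∀ s, stepOp ν a f s ≤ f s - g s)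
    (K : ℕ) :
    ∫ u, f (chain a x u K) ∂(Measure.infinitePi fun _ : ℕ => ν) ≤
      f x - ∑ k ∈ Finset.range K, ∫ u, g (chain a x u k) ∂(Measure.infinitePi fun _ : ℕ => ν) := by
  induction K with
  | zero => simp [chain]
  | succ K ih =>
    rw [integral_chain_succ, Finset.sum_range_succ]
    have h1 := integral_mono (integrable_chain ν a x (stepOp ν a f) K)
      (integrable_chain ν a x (fun s => f s - g s) K) (fun u => h (chain a x u K))
    rw [integral_sub (integrable_chain ν a x f K) (integrable_chain ν a x g K)] at h1
    linarith

omit [DiscreteMeasurableSpace U] [Finite U] [MeasurableSpace S] [DiscreteMeasurableSpace S]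
  [Finite S] in
open Classical in
theorem stepOp_absorb (Z : Set S) (f : S → ℝ) (s : S) :
    stepOp ν (absorb Z a) f s = if s ∈ Z then f s else stepOp ν a f s := by
  by_cases h : s ∈ Z <;> simp [stepOp, absorb, h]

/-- The expected number of steps before `Z` is entered is at most the initial value of a
function with drift at most `-1` off `Z`. -/
theorem sum_real_chain_absorb_notMem_le (Z : Set S) (f : S → ℝ) (hf : ∀ s, 0 ≤ f s)
    (h : ∀ s ∉ Z, stepOp ν a f s ≤ f s - 1) (K : ℕ) :
    ∑ k ∈ Finset.range K, (Measure.infinitePi fun _ : ℕ => ν).real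
      {u | chain (absorb Z a) x u k ∉ Z} ≤ f x := by
  classical
  have h1 := integral_chain_le_of_stepOp_le ν (absorb Z a) x f (Zᶜ.indicator fun _ => 1) (fun s => by
    rw [stepOp_absorb]
    by_cases hs : s ∈ Z
    · simp [hs]
    · simpa [hs] using h s hs) K
  have h2 : 0 ≤ ∫ u, f (chain (absorb Z a) x u K) ∂(Measure.infinitePi fun _ : ℕ => ν) :=
    integral_nonneg fun u => hf _
  have h3 (k : ℕ) : ∫ u, Zᶜ.indicator (fun _ => (1 : ℝ)) (chain (absorb Z a) x u k)
      ∂(Measure.infinitePi fun _ : ℕ => ν) = (Measure.infinitePi fun _ : ℕ => ν).real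
      {u | chain (absorb Z a) x u k ∉ Z} :=
    (integral_indicator_chain ν (absorb Z a) x Zᶜ 1 k).trans (mul_one _)
  simp only [h3] at h1
  linarith

/-- A maximal inequality: if `f ≥ M` on `Z` and the drift of `f ≥ 0` off `Z` is at most `c`, then
`Z` is entered within `K` steps with probability at most `(f x + c * K) / M`. -/
theorem real_chain_absorb_mem_le (Z : Set S) (f : S → ℝ) (hf : ∀ s, 0 ≤ f s) {c M : ℝ} (hc : 0 ≤ c)
    (h : ∀ s ∉ Z, stepOp ν a f s ≤ f s + c) (hM : ∀ s ∈ Z, M ≤ f s) (K : ℕ) :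
    (Measure.infinitePi fun _ : ℕ => ν).real {u | chain (absorb Z a) x u K ∈ Z} * M
      ≤ f x + K * c := by
  classical
  have h1 := integral_chain_le_of_stepOp_le ν (absorb Z a) x f (fun _ => -c) (fun s => by
    rw [stepOp_absorb]
    by_cases hs : s ∈ Z
    · simpa [hs] using hc
    · simpa [hs] using h s hs) K
  have h2 := integral_mono (integrable_chain ν (absorb Z a) x (Z.indicator fun _ => M) K)
    (integrable_chain ν (absorb Z a) x f K) (fun u => by
      by_cases hs : chain (absorb Z a) x u K ∈ Z
      · simpa [hs] using hM _ hs
      · simpa [hs] using hf _)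
  rw [integral_indicator_chain] at h2
  simp only [integral_const, probReal_univ, smul_eq_mul, one_mul, Finset.sum_const,
    Finset.card_range, nsmul_eq_mul] at h1
  linarith

end Chain

/-! ### Averaging over one update; the count as a birth-death chain -/

theorem integral_toMeasure_bind {α β : Type*} [Fintype α] [Finite β] [MeasurableSpace β]
    [DiscreteMeasurableSpace β] (p : PMF α) (q : α → PMF β) (f : β → ℝ) :
    ∫ b, f b ∂(p.bind q).toMeasure = ∑ a, (p a).toReal * ∫ b, f b ∂(q a).toMeasure := by
  have := Fintype.ofFinite β
  simp only [PMF.integral_eq_sum, PMF.bind_apply, tsum_fintype, smul_eq_mul, Finset.mul_sum]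
  rw [Finset.sum_comm]
  refine Finset.sum_congr rfl fun b _ => ?_
  rw [ENNReal.toReal_sum fun a _ => ENNReal.mul_ne_top (p.apply_ne_top a) ((q a).apply_ne_top b),
    Finset.sum_mul]
  simp [mul_assoc]

theorem integral_toMeasure_pure {β : Type*} [Finite β] [MeasurableSpace β]
    [DiscreteMeasurableSpace β] (b : β) (f : β → ℝ) :
    ∫ x, f x ∂(PMF.pure b).toMeasure = f b := by
  rw [PMF.toMeasure_pure, integral_dirac]

instance (V : Type*) [Finite V] : Finite (Update V) :=
  Finite.of_injective
    (fun e : Update V => (e.node, e.fails, e.coin, e.nbr₁, e.nbr₂)) (by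
      rintro ⟨⟩ ⟨⟩ h
      simpa using h)

section Count

variable {V : Type*}

/-- The opinion of the updating node after the update. -/
def Update.newOpinion (e : Update V) (x : State V) : Bool :=
  if e.fails = true then e.coin else if x e.nbr₁ = x e.nbr₂ then x e.nbr₁ else x e.node

theorem Update.apply_eq [DecidableEq V] (e : Update V) (x : State V) :
    e.apply x = Function.update x e.node (e.newOpinion x) := by
  unfold Update.apply Update.newOpinion
  split_ifs <;> simp

variable [Fintype V]

/-- The number of nodes holding the opinion `c`. -/
def count (c : Bool) (x : State V) : ℕ := (Finset.univ.filter fun v => x v = c).card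

theorem count_add_count (c : Bool) (x : State V) : count c x + count (!c) x = Fintype.card V := by
  have h := Finset.card_filter_add_card_filter_not (s := (Finset.univ : Finset V)) fun v => x v = c
  rw [Finset.card_univ] at h
  rw [← h, count, count]
  congr 2
  ext v
  cases c <;> simp

theorem count_eq_sum (c : Bool) (x : State V) :
    (count c x : ℝ) = ∑ v, if x v = c then (1 : ℝ) else 0 := by
  simp [count]

theorem count_update [DecidableEq V] (c : Bool) (x : State V) (v : V) (b : Bool) :
    (count c (Function.update x v b) : ℝ) =
      count c x - (if x v = c then 1 else 0) + if b = c then 1 else 0 := by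
  rw [count_eq_sum, count_eq_sum, ← Finset.add_sum_erase _ _ (Finset.mem_univ v),
    ← Finset.add_sum_erase (Finset.univ) _ (Finset.mem_univ v)]
  rw [Finset.sum_congr rfl fun w hw => by
    rw [Function.update_of_ne (Finset.ne_of_mem_erase hw)]]
  rw [Function.update_self]
  ring

end Count

section UpdateLaw

variable {V : Type*} [Fintype V] [DecidableEq V] [Nonempty V]
  [DecidableRel (⊤ : SimpleGraph V).Adj] (α : unitInterval)

theorem integral_updateLaw (hV : 2 ≤ Fintype.card V) (g : Update V → ℝ) :
    ∫ e, g e ∂(updateLaw (⊤ : SimpleGraph V) α).toMeasure =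
      (Fintype.card V : ℝ)⁻¹ * ∑ v, (((Fintype.card V : ℝ) - 1) ^ 2)⁻¹ *
        ∑ u ∈ Finset.univ.erase v, ∑ w ∈ Finset.univ.erase v,
          (α * ((g ⟨v, true, true, u, w⟩ + g ⟨v, true, false, u, w⟩) / 2) +
            (1 - α) * ((g ⟨v, false, true, u, w⟩ + g ⟨v, false, false, u, w⟩) / 2)) := by
  have hnb (v : V) : (⊤ : SimpleGraph V).neighborFinset v = Finset.univ.erase v := by
    ext w
    simp [eq_comm]
  have hcard (v : V) : (((Finset.univ.erase v).card : ℕ) : ℝ) = (Fintype.card V : ℝ) - 1 := by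
    rw [Finset.card_erase_of_mem (Finset.mem_univ v), Finset.card_univ, Nat.cast_sub (by omega)]
    simp
  have hne (v : V) : (Finset.univ.erase v).Nonempty := by
    rw [← Finset.card_pos, Finset.card_erase_of_mem (Finset.mem_univ v), Finset.card_univ]
    omega
  have hlaw (v : V) : neighbourLaw (⊤ : SimpleGraph V) v =
      PMF.uniformOfFinset (Finset.univ.erase v) (hne v) := by
    simp only [neighbourLaw, hnb, hne, dif_pos]
  have huni (v : V) (F : V → ℝ) : ∑ u, ((neighbourLaw (⊤ : SimpleGraph V) v) u).toReal * F u =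
      ((Fintype.card V : ℝ) - 1)⁻¹ * ∑ u ∈ Finset.univ.erase v, F u := by
    rw [hlaw, Finset.mul_sum, ← Finset.sum_subset (Finset.subset_univ (Finset.univ.erase v))]
    · refine Finset.sum_congr rfl fun u hu => ?_
      rw [PMF.uniformOfFinset_apply_of_mem _ hu, ENNReal.toReal_inv, ENNReal.toReal_natCast, hcard]
    · intro u _ hu
      rw [PMF.uniformOfFinset_apply_of_notMem _ hu]
      simp
  have hf0 : (0 : ℝ) ≤ α := α.2.1
  have hf1 : (0 : ℝ) ≤ 1 - α := by linarith [α.2.2]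
  simp only [updateLaw, integral_toMeasure_bind, integral_toMeasure_pure, huni]
  simp only [PMF.uniformOfFintype_apply, ENNReal.toReal_inv, ENNReal.toReal_natCast,
    Fintype.sum_bool, failureLaw, PMF.ofFintype_apply, if_true, Bool.false_eq_true, if_false,
    ENNReal.toReal_ofReal hf0, ENNReal.toReal_ofReal hf1, Fintype.card_bool]
  rw [← Finset.mul_sum]
  congr 1
  refine Finset.sum_congr rfl fun v _ => ?_
  simp only [Finset.mul_sum, ← Finset.sum_add_distrib]
  refine Finset.sum_congr rfl fun u _ => Finset.sum_congr rfl fun w _ => ?_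
  rw [sq, mul_inv]
  push_cast
  ring

/-- On a complete graph with at least two nodes no node samples itself, so updates in which one does
have no mass and need no comparison. -/
theorem integral_updateLaw_mono (hV : 2 ≤ Fintype.card V) {g h : Update V → ℝ}
    (hgh : ∀ e, e.nbr₁ ≠ e.node → e.nbr₂ ≠ e.node → g e ≤ h e) :
    ∫ e, g e ∂(updateLaw (⊤ : SimpleGraph V) α).toMeasure ≤
      ∫ e, h e ∂(updateLaw (⊤ : SimpleGraph V) α).toMeasure := by
  have hf0 : (0 : ℝ) ≤ α := α.2.1
  have hf1 : (0 : ℝ) ≤ 1 - α := by linarith [α.2.2]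
  rw [integral_updateLaw α hV, integral_updateLaw α hV]
  have h1 (v u w : V) (hu : u ∈ Finset.univ.erase v) (hw : w ∈ Finset.univ.erase v) (b c : Bool) :
      g ⟨v, b, c, u, w⟩ ≤ h ⟨v, b, c, u, w⟩ :=
    hgh _ (Finset.ne_of_mem_erase hu) (Finset.ne_of_mem_erase hw)
  gcongr with v _ u hu w hw <;> exact h1 _ _ _ hu hw _ _

/-- The probability that an update increases the number `h` of nodes with a given opinion. -/
noncomputable def upProb (α n h : ℝ) : ℝ :=
  (n - h) / n * (α / 2 + (1 - α) * (h / (n - 1)) ^ 2)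

/-- The transition operator of the configuration on the complete graph, embedded at the update
times. -/
noncomputable abbrev transOp (f : State V → ℝ) : State V → ℝ :=
  stepOp (updateLaw (⊤ : SimpleGraph V) α).toMeasure Update.apply f

/-- The number of nodes with a given opinion is a birth-death chain. -/
theorem transOp_count (hV : 2 ≤ Fintype.card V) (c : Bool) (F : ℝ → ℝ) (x : State V) :
    transOp α (fun y => F (count c y)) x =
      F (count c x) + upProb α (Fintype.card V) (count c x) * (F (count c x + 1) - F (count c x)) +
        upProb α (Fintype.card V) (Fintype.card V - count c x) *
          (F (count c x - 1) - F (count c x)) := by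
  have hn : (2 : ℝ) ≤ Fintype.card V := by exact_mod_cast hV
  set n : ℝ := ((Fintype.card V : ℕ) : ℝ) with hndef
  set h : ℝ := ((count c x : ℕ) : ℝ) with hh
  have hm : n - 1 ≠ 0 := by linarith
  have hcard (v : V) : (((Finset.univ.erase v).card : ℕ) : ℝ) = n - 1 := by
    rw [Finset.card_erase_of_mem (Finset.mem_univ v), Finset.card_univ, Nat.cast_sub (by omega)]
    simp [hndef]
  have hsum : ∑ v, (if x v = c then (1 : ℝ) else 0) = h := (count_eq_sum c x).symm
  have hsum' : ∑ v, (if x v = c then (0 : ℝ) else 1) = n - h := by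
    rw [← hsum, hndef, ← Finset.card_univ, Finset.card_eq_sum_ones]
    push_cast
    rw [← Finset.sum_sub_distrib]
    refine Finset.sum_congr rfl fun v _ => ?_
    split_ifs <;> simp
  have hfun (e : Update V) : (count c (e.apply x) : ℝ) =
      h - (if x e.node = c then 1 else 0) + if e.newOpinion x = c then 1 else 0 := by
    rw [Update.apply_eq, count_update]
  have hv (v : V) : ((n - 1) ^ 2)⁻¹ *
        ∑ u ∈ Finset.univ.erase v, ∑ w ∈ Finset.univ.erase v,
          (α * ((F (count c ((⟨v, true, true, u, w⟩ : Update V).apply x)) +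
            F (count c ((⟨v, true, false, u, w⟩ : Update V).apply x))) / 2) +
            (1 - α) * ((F (count c ((⟨v, false, true, u, w⟩ : Update V).apply x)) +
            F (count c ((⟨v, false, false, u, w⟩ : Update V).apply x))) / 2)) =
        F h + (if x v = c then (α / 2 + (1 - α) * ((n - h) / (n - 1)) ^ 2) * (F (h - 1) - F h)
          else (α / 2 + (1 - α) * (h / (n - 1)) ^ 2) * (F (h + 1) - F h)) := by
    by_cases hc : x v = c
    · have hterm (u w : V) : (α * ((F (count c ((⟨v, true, true, u, w⟩ : Update V).apply x)) +
            F (count c ((⟨v, true, false, u, w⟩ : Update V).apply x))) / 2) +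
            (1 - α) * ((F (count c ((⟨v, false, true, u, w⟩ : Update V).apply x)) +
            F (count c ((⟨v, false, false, u, w⟩ : Update V).apply x))) / 2)) =
          F h + (α / 2) * (F (h - 1) - F h) + (1 - α) * (F (h - 1) - F h) *
            ((if x u = c then 0 else 1) * (if x w = c then 0 else 1)) := by
        simp only [hfun, Update.newOpinion]
        cases c <;> cases h1 : x u <;> cases h2 : x w <;> simp [hc] <;> ring
      -- The updating node holds `c` and so adds nothing to this sum; leaving it out of the sample
      -- changes only the denominator, to `n - 1`.
      have he : ∑ u ∈ Finset.univ.erase v, (if x u = c then (0 : ℝ) else 1) = n - h := by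
        rw [← hsum', Finset.sum_erase]
        simp [hc]
      simp only [hterm, Finset.sum_add_distrib, Finset.sum_const, nsmul_eq_mul, hcard,
        ← Finset.mul_sum, ← Finset.sum_mul, he, if_pos hc]
      field_simp
      ring
    · have hterm (u w : V) : (α * ((F (count c ((⟨v, true, true, u, w⟩ : Update V).apply x)) +
            F (count c ((⟨v, true, false, u, w⟩ : Update V).apply x))) / 2) +
            (1 - α) * ((F (count c ((⟨v, false, true, u, w⟩ : Update V).apply x)) +
            F (count c ((⟨v, false, false, u, w⟩ : Update V).apply x))) / 2)) =
          F h + (α / 2) * (F (h + 1) - F h) + (1 - α) * (F (h + 1) - F h) *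
            ((if x u = c then 1 else 0) * (if x w = c then 1 else 0)) := by
        simp only [hfun, Update.newOpinion]
        cases c <;> cases h0 : x v <;> cases h1 : x u <;> cases h2 : x w <;> simp_all <;> ring
      have he : ∑ u ∈ Finset.univ.erase v, (if x u = c then (1 : ℝ) else 0) = h := by
        rw [← hsum, Finset.sum_erase]
        simp [hc]
      simp only [hterm, Finset.sum_add_distrib, Finset.sum_const, nsmul_eq_mul, hcard,
        ← Finset.mul_sum, ← Finset.sum_mul, he, if_neg hc]
      field_simp
      ring
  have hsplit (A B : ℝ) : ∑ v, (if x v = c then A else B) = h * A + (n - h) * B := by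
    rw [← hsum', ← hsum, Finset.sum_mul, Finset.sum_mul, ← Finset.sum_add_distrib]
    refine Finset.sum_congr rfl fun v _ => ?_
    split_ifs <;> simp
  rw [transOp, stepOp, integral_updateLaw α hV, ← hndef, Finset.sum_congr rfl fun v _ => hv v]
  simp only [Finset.sum_add_distrib, hsplit, Finset.sum_const, nsmul_eq_mul,
    Finset.card_univ, ← hndef, upProb]
  have : n ≠ 0 := by linarith
  field_simp
  ring

end UpdateLaw

/-! ### Path coupling -/

section Contraction

variable {V : Type*} [DecidableEq V]

/-- The indicator that the nodes `v` and `w` disagree. -/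
def disagree (x : State V) (v w : V) : ℝ := if x w = x v then 0 else 1

/-- A bound for the number of nodes at which two configurations that differ only at `z` differ
after a common update. -/
def discrepancy (x : State V) (z : V) (e : Update V) : ℝ :=
  if e.node = z then if e.fails = true then 0 else disagree x e.nbr₁ e.nbr₂
  else 1 + if e.fails = true then 0 else
    if e.nbr₁ = z then if e.nbr₂ = z then 1 else disagree x e.node e.nbr₂
    else if e.nbr₂ = z then disagree x e.node e.nbr₁ else 0

/-- Both configurations receive the same update. If `z` is updated, the difference survives only
when the node does not fail and its samples disagree. Another node can become different only if it
samples `z`, and, when it does so once, only if its other sample disagrees with it. -/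
theorem abs_apply_update_sub_le (f : State V → ℝ) {L : ℝ}
    (hf : ∀ x z b, |f (Function.update x z b) - f x| ≤ L) (x : State V) (z : V) (b : Bool)
    (e : Update V) (h1 : e.nbr₁ ≠ e.node) (h2 : e.nbr₂ ≠ e.node) :
    |f (e.apply (Function.update x z b)) - f (e.apply x)| ≤ L * discrepancy x z e := by
  obtain ⟨v, fl, cn, u, w⟩ := e
  simp only at h1 h2
  have same (s : Bool) (hv : v ≠ z) : |f (Function.update (Function.update x z b) v s) -
      f (Function.update x v s)| ≤ L := by
    rw [Function.update_comm hv.symm]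
    exact hf _ _ _
  -- The configurations now differ at `z` and possibly at `v`, hence two single-node changes and the
  -- factor `2`.
  have diff (s t : Bool) (hv : v ≠ z) : |f (Function.update (Function.update x z b) v s) -
      f (Function.update x v t)| ≤ L * 2 := by
    have h3 := abs_sub_le (f (Function.update (Function.update x z b) v s))
      (f (Function.update x v s)) (f (Function.update x v t))
    have h4 := hf (Function.update x v t) v s
    rw [Function.update_idem] at h4
    linarith [same s hv]
  rw [Update.apply_eq, Update.apply_eq]
  simp only [Update.newOpinion, discrepancy]
  by_cases hv : v = z
  · subst hv
    rw [Function.update_idem]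
    cases fl
    · simp only [Function.update_of_ne h1, Function.update_of_ne h2, Bool.false_eq_true, if_false,
        if_true, Function.update_self, disagree]
      by_cases h : x u = x w
      · simp [h]
      · rw [if_neg h, if_neg h, if_neg (Ne.symm h), mul_one, Function.update_eq_self]
        exact hf _ _ _
    · simp
  · cases fl
    · simp only [Bool.false_eq_true, if_false, if_neg hv, Function.update_of_ne hv]
      by_cases hu : u = z
      · subst hu
        by_cases hw : w = u
        · subst hw
          simp only [if_true]
          convert diff _ _ hv using 1
          norm_num
        · simp only [if_neg hw, Function.update_of_ne hw, Function.update_self, if_true, disagree]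
          by_cases h : x w = x v
          · have e1 : (if b = x w then b else x v) = x v := by
              split_ifs with h' <;> simp [h', h]
            have e2 : (if x u = x w then x u else x v) = x v := by
              split_ifs with h' <;> simp [h', h]
            rw [e1, e2, if_pos h, add_zero, mul_one]
            exact same _ hv
          · rw [if_neg h]
            convert diff _ _ hv using 1
            norm_num
      · by_cases hw : w = z
        · subst hw
          simp only [if_neg hu, Function.update_of_ne hu, Function.update_self, if_true, disagree]
          by_cases h : x u = x v
          · rw [if_pos h, add_zero, mul_one]
            simp only [h, ite_self]
            exact same _ hv
          · rw [if_neg h]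
            convert diff _ _ hv using 1
            norm_num
        · simp only [if_neg hu, if_neg hw, Function.update_of_ne hu, Function.update_of_ne hw,
            add_zero, mul_one]
          exact same _ hv
    · simp only [if_true, if_neg hv, add_zero, mul_one]
      exact same _ hv

variable [Fintype V] [Nonempty V] [DecidableRel (⊤ : SimpleGraph V).Adj] (α : unitInterval)

/-- With `m = n - 1` and `a` ones among the nodes other than `z`, the ordered disagreeing pairs
number `2a(m-a)`. They count once when `z` is updated and twice when another node samples `z`, so
the mean is `(m + (1-α)/m + 6(1-α) a(m-a)/m^2)/n`. The maximum of `a(m-a)` is `m^2/4`, and `1 -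
3(1-α)/2 = (3α-1)/2` gives the threshold. -/
theorem integral_discrepancy_le (hV : 2 ≤ Fintype.card V) (x : State V) (z : V) :
    ∫ e, discrepancy x z e ∂(updateLaw (⊤ : SimpleGraph V) α).toMeasure ≤
      1 - ((3 * α - 1) / 2 - (1 - α) / ((Fintype.card V : ℝ) - 1)) / Fintype.card V := by
  have hn : (2 : ℝ) ≤ Fintype.card V := by exact_mod_cast hV
  have hα : (0 : ℝ) ≤ 1 - α := by linarith [α.2.2]
  obtain ⟨m, hm⟩ : ∃ m : ℝ, m = ((Fintype.card V : ℕ) : ℝ) - 1 := ⟨_, rfl⟩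
  have hn' : (Fintype.card V : ℝ) = m + 1 := by rw [hm]; ring
  have hm1 : 1 ≤ m := by linarith
  have hcard (v : V) : (((Finset.univ.erase v).card : ℕ) : ℝ) = m := by
    rw [Finset.card_erase_of_mem (Finset.mem_univ v), Finset.card_univ, Nat.cast_sub (by omega), hm]
    simp
  let i : V → ℝ := fun v => if x v = true then 1 else 0
  have hdis (v w : V) : disagree x v w = i v + i w - 2 * (i v * i w) := by
    simp only [disagree, i]
    cases x v <;> cases x w <;> norm_num
  have hself (v : V) : disagree x v v = 0 := by simp [disagree]
  set a : ℝ := ∑ u ∈ Finset.univ.erase z, i u with ha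
  have hdz (v : V) : ∑ w ∈ Finset.univ.erase z, disagree x v w = m * i v + a - 2 * (i v * a) := by
    simp only [hdis, Finset.sum_sub_distrib, Finset.sum_add_distrib, Finset.sum_const, hcard,
      nsmul_eq_mul, ← Finset.mul_sum, ← ha]
  have hdd : ∑ v ∈ Finset.univ.erase z, ∑ w ∈ Finset.univ.erase z, disagree x v w =
      2 * a * (m - a) := by
    simp only [hdz, Finset.sum_sub_distrib, Finset.sum_add_distrib, Finset.sum_const, hcard,
      nsmul_eq_mul, ← Finset.mul_sum, ← Finset.sum_mul, ← ha]
    ring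
  have hex (v : V) : ∑ w ∈ Finset.univ.erase v, (if w = z then 0 else disagree x v w) =
      ∑ w ∈ Finset.univ.erase z, disagree x v w := by
    rw [Finset.sum_erase _ (by simp [hself])]
    rw [← Finset.sum_erase (a := z) _ (by simp)]
    exact Finset.sum_congr rfl fun w hw => if_neg (Finset.ne_of_mem_erase hw)
  have hpair (v : V) (hv : v ≠ z) : ∑ u ∈ Finset.univ.erase v, ∑ w ∈ Finset.univ.erase v,
      (if u = z then if w = z then 1 else disagree x v w
        else if w = z then disagree x v u else 0) =
      1 + 2 * ∑ w ∈ Finset.univ.erase z, disagree x v w := by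
    have hterm (u w : V) : (if u = z then if w = z then 1 else disagree x v w
        else if w = z then disagree x v u else 0) =
        (if u = z then 1 else 0) * (if w = z then 1 else 0) +
        (if u = z then 1 else 0) * (if w = z then 0 else disagree x v w) +
        (if u = z then 0 else disagree x v u) * (if w = z then 1 else 0) := by
      split_ifs <;> simp
    have hone : ∑ u ∈ Finset.univ.erase v, (if u = z then (1 : ℝ) else 0) = 1 := by
      simp [hv.symm]
    simp only [hterm, Finset.sum_add_distrib, ← Finset.mul_sum, ← Finset.sum_mul, hone, hex]
    ring
  rw [integral_updateLaw α hV, ← hm, ← Finset.add_sum_erase _ _ (Finset.mem_univ z)]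
  have hz : ∑ u ∈ Finset.univ.erase z, ∑ w ∈ Finset.univ.erase z,
      (α * ((discrepancy x z ⟨z, true, true, u, w⟩ + discrepancy x z ⟨z, true, false, u, w⟩) / 2) +
        (1 - α) * ((discrepancy x z ⟨z, false, true, u, w⟩ +
          discrepancy x z ⟨z, false, false, u, w⟩) / 2)) = (1 - α) * (2 * a * (m - a)) := by
    simp only [discrepancy, if_true, Bool.false_eq_true, if_false]
    simp only [add_zero, zero_div, mul_zero, zero_add, add_self_div_two, ← Finset.mul_sum, hdd]
  have hv (v : V) (hv : v ∈ Finset.univ.erase z) : (m ^ 2)⁻¹ *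
      ∑ u ∈ Finset.univ.erase v, ∑ w ∈ Finset.univ.erase v,
      (α * ((discrepancy x z ⟨v, true, true, u, w⟩ + discrepancy x z ⟨v, true, false, u, w⟩) / 2) +
        (1 - α) * ((discrepancy x z ⟨v, false, true, u, w⟩ +
          discrepancy x z ⟨v, false, false, u, w⟩) / 2)) =
      1 + (m ^ 2)⁻¹ * (1 - α) * (1 + 2 * ∑ w ∈ Finset.univ.erase z, disagree x v w) := by
    have hvz := Finset.ne_of_mem_erase hv
    simp only [discrepancy, if_true, Bool.false_eq_true, if_false, if_neg hvz]
    simp only [add_zero, add_self_div_two, mul_add, Finset.sum_add_distrib]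
    simp only [← Finset.mul_sum, hpair v hvz, Finset.sum_const, hcard, nsmul_eq_mul]
    field_simp
    ring
  rw [hz, Finset.sum_congr rfl hv]
  simp only [Finset.sum_add_distrib, Finset.sum_const, hcard, nsmul_eq_mul, ← Finset.mul_sum,
    hdd, hn']
  have key : (1 - (α : ℝ)) * (6 * (a * (m - a))) ≤ (1 - α) * (6 * (m ^ 2 / 4)) := by
    gcongr
    nlinarith [sq_nonneg (m - 2 * a)]
  have e1 : (m + 1)⁻¹ * ((m ^ 2)⁻¹ * ((1 - (α : ℝ)) * (2 * a * (m - a))) +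
      (m * 1 + (m ^ 2)⁻¹ * (1 - α) * (m * 1 + 2 * (2 * a * (m - a))))) =
      (m + 1)⁻¹ * (m + (1 - α) / m + (1 - α) * (6 * (a * (m - a))) / m ^ 2) := by
    field_simp
    ring
  have e2 : 1 - ((3 * (α : ℝ) - 1) / 2 - (1 - α) / m) / (m + 1) =
      (m + 1)⁻¹ * (m + (1 - α) / m + (1 - α) * (6 * (m ^ 2 / 4)) / m ^ 2) := by
    field_simp
    ring
  rw [e1, e2]
  gcongr

/-- The dual form of path coupling: the common update couples the two one-step laws, so the mean
discrepancy multiplies the Lipschitz constant. -/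
theorem transOp_lipschitz (hV : 2 ≤ Fintype.card V) (f : State V → ℝ) {L : ℝ} (hL : 0 ≤ L)
    (hf : ∀ x z b, |f (Function.update x z b) - f x| ≤ L) (x : State V) (z : V) (b : Bool) :
    |transOp α f (Function.update x z b) - transOp α f x| ≤
      L * (1 - ((3 * α - 1) / 2 - (1 - α) / ((Fintype.card V : ℝ) - 1)) / Fintype.card V) := by
  have hd : ∫ e, L * discrepancy x z e ∂(updateLaw (⊤ : SimpleGraph V) α).toMeasure ≤
      L * (1 - ((3 * α - 1) / 2 - (1 - α) / ((Fintype.card V : ℝ) - 1)) / Fintype.card V) := by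
    rw [integral_const_mul]
    exact mul_le_mul_of_nonneg_left (integral_discrepancy_le α hV x z) hL
  refine le_trans ?_ hd
  rw [transOp, stepOp, stepOp, ← integral_sub .of_finite .of_finite, abs_le, ← integral_neg]
  constructor <;> refine integral_updateLaw_mono α hV fun e h1 h2 => ?_
  · exact (abs_le.1 (abs_apply_update_sub_le f hf x z b e h1 h2)).1
  · exact (abs_le.1 (abs_apply_update_sub_le f hf x z b e h1 h2)).2

/-- The contraction factor of one update. -/
noncomputable def contraction (α n : ℝ) : ℝ :=
  1 - ((3 * α - 1) / 2 - (1 - α) / (n - 1)) / n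

theorem iterate_transOp_lipschitz (hV : 2 ≤ Fintype.card V) (f : State V → ℝ)
    (hρ : 0 ≤ contraction α (Fintype.card V))
    (hf : ∀ x z b, |f (Function.update x z b) - f x| ≤ 1) (k : ℕ) (x : State V) (z : V) (b : Bool) :
    |(transOp α)^[k] f (Function.update x z b) - (transOp α)^[k] f x| ≤
      contraction α (Fintype.card V) ^ k := by
  induction k generalizing x z b with
  | zero => simpa using hf x z b
  | succ k ih =>
    rw [Function.iterate_succ_apply', pow_succ]
    exact transOp_lipschitz α hV _ (pow_nonneg hρ k) ih x z b

omit [Nonempty V] [DecidableRel (⊤ : SimpleGraph V).Adj] in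
-- The opinions of `x` are replaced by those of `y` one node at a time.
theorem abs_sub_le_card_mul (f : State V → ℝ) {L : ℝ}
    (hf : ∀ x z b, |f (Function.update x z b) - f x| ≤ L) (x y : State V) :
    |f y - f x| ≤ Fintype.card V * L := by
  suffices h : ∀ s : Finset V, |f (s.piecewise y x) - f x| ≤ s.card * L by
    simpa using h Finset.univ
  intro s
  induction s using Finset.induction_on with
  | empty => simp
  | insert v s hv ih =>
    rw [Finset.piecewise_insert, Finset.card_insert_of_notMem hv]
    have h1 := hf (s.piecewise y x) v (y v)
    have h2 := abs_sub_le (f (Function.update (s.piecewise y x) v (y v))) (f (s.piecewise y x)) (f x)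
    push_cast
    linarith

/-- The laws of the configuration after `k` updates from two initial configurations approach each
other geometrically. -/
theorem abs_iterate_transOp_sub_le (hV : 2 ≤ Fintype.card V) (f : State V → ℝ)
    (hρ : 0 ≤ contraction α (Fintype.card V)) (hf : ∀ x, f x ∈ Set.Icc (0 : ℝ) 1) (k : ℕ)
    (x y : State V) :
    |(transOp α)^[k] f y - (transOp α)^[k] f x| ≤
      Fintype.card V * contraction α (Fintype.card V) ^ k := by
  refine abs_sub_le_card_mul _ (iterate_transOp_lipschitz α hV f hρ (fun x z b => ?_) k) x y
  rw [abs_le]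
  constructor <;> linarith [(hf x).1, (hf x).2, (hf (Function.update x z b)).1,
    (hf (Function.update x z b)).2]

end Contraction

/-! ### Poisson clock: waiting times and number of updates -/

section Times

/-- The law of the sequence of waiting times of a Poisson process of rate `r`. -/
noncomputable abbrev waitingLaw (r : ℝ) : Measure (ℕ → ℝ) :=
  Measure.infinitePi fun _ : ℕ => expMeasure r

variable {r : ℝ}

/-- Exponential tilting turns the density of rate `r` into a multiple of the density of rate `r +
l`. -/
theorem lintegral_exp_neg_expMeasure (hr : 0 < r) {l : ℝ} (hl : 0 ≤ l) :
    ∫⁻ w, ENNReal.ofReal (Real.exp (-(l * w))) ∂(expMeasure r) = ENNReal.ofReal (r / (r + l)) := by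
  have hrl : 0 < r + l := by linarith
  rw [expMeasure, gammaMeasure, lintegral_withDensity_eq_lintegral_mul _
    (show Measurable (gammaPDF 1 r) from (measurable_gammaPDFReal 1 r).ennreal_ofReal)
    (by fun_prop)]
  have h (w : ℝ) : (gammaPDF 1 r * fun w => ENNReal.ofReal (Real.exp (-(l * w)))) w =
      ENNReal.ofReal (r / (r + l)) * gammaPDF 1 (r + l) w := by
    simp only [Pi.mul_apply, gammaPDF, gammaPDFReal]
    rw [← ENNReal.ofReal_mul' (Real.exp_pos _).le, ← ENNReal.ofReal_mul (by positivity)]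
    congr 1
    split_ifs
    · simp only [Real.rpow_one, Real.Gamma_one, sub_self, Real.rpow_zero]
      rw [mul_assoc, ← Real.exp_add, show -(r * w) + -(l * w) = -((r + l) * w) by ring]
      field_simp
    · simp
  simp only [h]
  rw [lintegral_const_mul _ (show Measurable (gammaPDF 1 (r + l)) from
    (measurable_gammaPDFReal 1 (r + l)).ennreal_ofReal),
    lintegral_gammaPDF_eq_one one_pos hrl, mul_one]

theorem lintegral_ofReal_expMeasure (hr : 0 < r) :
    ∫⁻ w, ENNReal.ofReal w ∂(expMeasure r) = ENNReal.ofReal (1 / r) := by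
  rw [expMeasure, gammaMeasure, lintegral_withDensity_eq_lintegral_mul _
    (show Measurable (gammaPDF 1 r) from (measurable_gammaPDFReal 1 r).ennreal_ofReal)
    (by fun_prop)]
  have h (w : ℝ) : (gammaPDF 1 r * fun w => ENNReal.ofReal w) w =
      ENNReal.ofReal (1 / r) * gammaPDF 2 r w := by
    simp only [Pi.mul_apply, gammaPDF]
    rw [← ENNReal.ofReal_mul (gammaPDFReal_nonneg one_pos hr w),
      ← ENNReal.ofReal_mul (by positivity)]
    congr 1
    simp only [gammaPDFReal]
    split_ifs
    · simp only [Real.rpow_one, Real.Gamma_one, Real.Gamma_two, sub_self, Real.rpow_zero,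
        Real.rpow_two, show (2 : ℝ) - 1 = 1 by norm_num]
      field_simp
    · simp
  simp only [h]
  rw [lintegral_const_mul _ (show Measurable (gammaPDF 2 r) from
    (measurable_gammaPDFReal 2 r).ennreal_ofReal),
    lintegral_gammaPDF_eq_one two_pos hr, mul_one]

theorem ae_pos_expMeasure : ∀ᵐ w ∂(expMeasure r), 0 < w := by
  have h1 : expMeasure r {0} = 0 := by
    rw [expMeasure, gammaMeasure]
    exact withDensity_absolutelyContinuous _ _ (by simp)
  have h2 : expMeasure r (Set.Iio 0) = 0 := by
    rw [expMeasure, gammaMeasure, withDensity_apply _ measurableSet_Iio]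
    exact lintegral_gammaPDF_of_nonpos le_rfl
  rw [ae_iff]
  refine measure_mono_null (t := {0} ∪ Set.Iio 0) (fun w hw => ?_) (measure_union_null h1 h2)
  simp only [Set.mem_ofPred_eq, not_lt] at hw
  rcases hw.lt_or_eq with h | h
  · exact .inr h
  · exact .inl h

theorem ae_pos_waitingLaw (hr : 0 < r) : ∀ᵐ s ∂(waitingLaw r), ∀ i, 0 < s i := by
  have := isProbabilityMeasure_expMeasure hr
  rw [ae_all_iff]
  intro i
  exact (measurePreserving_eval_infinitePi (fun _ : ℕ => expMeasure r) i).quasiMeasurePreserving.ae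
    (ae_pos_expMeasure)

theorem lintegral_eval_waitingLaw (hr : 0 < r) (i : ℕ) :
    ∫⁻ s, ENNReal.ofReal (s i) ∂(waitingLaw r) = ENNReal.ofReal (1 / r) := by
  have := isProbabilityMeasure_expMeasure hr
  rw [← lintegral_ofReal_expMeasure hr]
  exact (measurePreserving_eval_infinitePi (fun _ : ℕ => expMeasure r) i).lintegral_comp
    (by fun_prop)

/-- Chernoff's bound with parameter `1/t` gives `e * (1 + 1/(r t))^(-k)`, and Bernoulli's inequality
bounds the power by `r t / k`. This polynomial decay is enough because `k` will be exponentially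
larger than `t`. -/
theorem waitingLaw_sum_le_le (hr : 0 < r) {t : ℝ} (ht : 0 < t) {k : ℕ} (hk : 0 < k) :
    waitingLaw r {s | ∑ i ∈ Finset.range k, s i ≤ t} ≤
      ENNReal.ofReal (Real.exp 1 * r * t / k) := by
  have := isProbabilityMeasure_expMeasure hr
  have hind : iIndepFun (fun (i : ℕ) (s : ℕ → ℝ) => ENNReal.ofReal (Real.exp (-(t⁻¹ * s i))))
      (waitingLaw r) :=
    iIndepFun_infinitePi (P := fun _ : ℕ => expMeasure r)
      (X := fun _ w => ENNReal.ofReal (Real.exp (-(t⁻¹ * w)))) (fun _ => by fun_prop)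
  have hprod := lintegral_prod_eq_prod_lintegral_of_indepFun (Finset.range k) _ hind
    (fun i => by fun_prop)
  have heach (i : ℕ) : ∫⁻ s, ENNReal.ofReal (Real.exp (-(t⁻¹ * s i))) ∂(waitingLaw r) =
      ENNReal.ofReal (r / (r + t⁻¹)) := by
    rw [← lintegral_exp_neg_expMeasure hr (inv_pos.2 ht).le]
    exact (measurePreserving_eval_infinitePi (fun _ : ℕ => expMeasure r) i).lintegral_comp
      (f := fun w => ENNReal.ofReal (Real.exp (-(t⁻¹ * w)))) (by fun_prop)
  simp only [heach, Finset.prod_const, Finset.card_range] at hprod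
  have hmarkov := meas_ge_le_lintegral_div (μ := waitingLaw r)
    (f := fun s => ∏ i ∈ Finset.range k, ENNReal.ofReal (Real.exp (-(t⁻¹ * s i))))
    (ε := ENNReal.ofReal (Real.exp (-1)))
    (Finset.measurable_fun_prod _ fun i _ => by fun_prop).aemeasurable
    (by simp [Real.exp_pos]) ENNReal.ofReal_ne_top
  rw [hprod, ← ENNReal.ofReal_pow (by positivity),
    ← ENNReal.ofReal_div_of_pos (Real.exp_pos _)] at hmarkov
  refine (measure_mono fun s hs => ?_).trans (hmarkov.trans (ENNReal.ofReal_le_ofReal ?_))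
  · simp only [Set.mem_ofPred_eq] at hs ⊢
    rw [← ENNReal.ofReal_prod_of_nonneg fun i _ => (Real.exp_pos _).le, ← Real.exp_sum]
    refine ENNReal.ofReal_le_ofReal (Real.exp_le_exp.2 ?_)
    rw [Finset.sum_neg_distrib, ← Finset.mul_sum, neg_le_neg_iff, inv_mul_le_iff₀ ht, mul_one]
    exact hs
  · have hk' : (0 : ℝ) < k := by exact_mod_cast hk
    have hb := one_add_mul_le_pow (a := (r * t)⁻¹) (by linarith [inv_pos.2 (mul_pos hr ht)]) k
    have e1 : r / (r + t⁻¹) = (1 + (r * t)⁻¹)⁻¹ := by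
      field_simp
    rw [e1, Real.exp_neg, div_inv_eq_mul, inv_pow, mul_comm, mul_assoc, mul_div_assoc]
    gcongr
    rw [inv_le_comm₀ (by positivity) (by positivity), inv_div]
    refine le_trans ?_ hb
    rw [div_eq_mul_inv]
    linarith

theorem waitingLaw_lt_sum_le (hr : 0 < r) {t : ℝ} (ht : 0 < t) (k : ℕ) :
    waitingLaw r {s | t < ∑ i ∈ Finset.range k, s i} ≤ ENNReal.ofReal (k / (r * t)) := by
  have hmarkov := meas_ge_le_lintegral_div (μ := waitingLaw r)
    (f := fun s => ∑ i ∈ Finset.range k, ENNReal.ofReal (s i))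
    (ε := ENNReal.ofReal t)
    (Finset.measurable_fun_sum _ fun i _ => by fun_prop).aemeasurable (by simpa using ht) ENNReal.ofReal_ne_top
  rw [lintegral_finsetSum _ (fun i _ => by fun_prop)] at hmarkov
  simp only [lintegral_eval_waitingLaw hr, Finset.sum_const, Finset.card_range, nsmul_eq_mul]
    at hmarkov
  refine (measure_mono fun s hs => ?_).trans (hmarkov.trans (le_of_eq ?_))
  · simp only [Set.mem_ofPred_eq] at hs ⊢
    calc ENNReal.ofReal t ≤ ENNReal.ofReal (∑ i ∈ Finset.range k, max (s i) 0) :=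
          ENNReal.ofReal_le_ofReal (hs.le.trans (Finset.sum_le_sum fun i _ => le_max_left _ _))
      _ = _ := by
          rw [ENNReal.ofReal_sum_of_nonneg fun i _ => le_max_right _ _]
          simp
  · rw [← ENNReal.ofReal_natCast, ← ENNReal.ofReal_mul (by positivity),
      ← ENNReal.ofReal_div_of_pos ht]
    congr 1
    field_simp

/-- The number of updates up to time `t`. -/
noncomputable def updatesUntil (t : ℝ) (s : ℕ → ℝ) : ℕ :=
  sInf {k : ℕ | t < ∑ i ∈ Finset.range (k + 1), s i}

theorem measurable_updatesUntil (t : ℝ) : Measurable (updatesUntil t) := by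
  have hS (k : ℕ) : MeasurableSet {s : ℕ → ℝ | t < ∑ i ∈ Finset.range (k + 1), s i} :=
    measurableSet_lt measurable_const (by fun_prop)
  refine measurable_of_Iic fun k => ?_
  -- If the partial sums never exceed `t`, the infimum of the empty set is `0`; the intersection
  -- accounts for this exceptional event.
  have : updatesUntil t ⁻¹' Set.Iic k =
      (⋃ j ∈ Set.Iic k, {s : ℕ → ℝ | t < ∑ i ∈ Finset.range (j + 1), s i}) ∪
        ⋂ j, {s : ℕ → ℝ | t < ∑ i ∈ Finset.range (j + 1), s i}ᶜ := by
    ext s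
    simp only [Set.mem_preimage, Set.mem_Iic, Set.mem_union, Set.mem_iUnion, Set.mem_ofPred_eq,
      Set.mem_iInter, Set.mem_compl_iff]
    constructor
    · intro h
      by_cases hne : {k : ℕ | t < ∑ i ∈ Finset.range (k + 1), s i}.Nonempty
      · exact .inl ⟨_, h, Nat.sInf_mem hne⟩
      · exact .inr fun j hj => hne ⟨j, hj⟩
    · rintro (⟨j, hj, hj'⟩ | h)
      · exact (Nat.sInf_le hj').trans hj
      · have : {k : ℕ | t < ∑ i ∈ Finset.range (k + 1), s i} = ∅ :=
          Set.eq_empty_of_forall_notMem h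
        simp [updatesUntil, this]
  rw [this]
  exact (MeasurableSet.biUnion (Set.to_countable _) fun j _ => hS j).union
    (MeasurableSet.iInter fun j => (hS j).compl)

theorem waitingLaw_updatesUntil_lt_le (hr : 0 < r) {t : ℝ} (ht : 0 < t) (k : ℕ) :
    waitingLaw r {s | updatesUntil t s < k} ≤ ENNReal.ofReal (k / (r * t)) := by
  -- The clock almost surely does not explode, so the default value `0` of the infimum is harmless.
  have hnull : waitingLaw r {s | ∀ j : ℕ, ∑ i ∈ Finset.range (j + 1), s i ≤ t} = 0 := by
    have hlim : Tendsto (fun j : ℕ => ENNReal.ofReal (Real.exp 1 * r * t / (j + 1 : ℕ))) atTop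
        (𝓝 0) := by
      rw [← ENNReal.ofReal_zero]
      exact ENNReal.tendsto_ofReal ((tendsto_const_div_atTop_nhds_zero_nat _).comp
        (tendsto_add_atTop_nat 1))
    refine le_antisymm (ge_of_tendsto' hlim fun j => ?_) bot_le
    have hsub : {s : ℕ → ℝ | ∀ j : ℕ, ∑ i ∈ Finset.range (j + 1), s i ≤ t} ⊆
        {s | ∑ i ∈ Finset.range (j + 1), s i ≤ t} := fun s hs => hs j
    exact (measure_mono hsub).trans (waitingLaw_sum_le_le hr ht j.succ_pos)
  refine le_trans ?_ (waitingLaw_lt_sum_le hr ht k)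
  refine measure_mono_ae ?_
  have hae : ∀ᵐ s ∂(waitingLaw r), ¬ ∀ j : ℕ, ∑ i ∈ Finset.range (j + 1), s i ≤ t := by
    rw [ae_iff]
    simpa using hnull
  filter_upwards [hae, ae_pos_waitingLaw hr] with s hs hpos hlt
  push Not at hs
  have hmem := Nat.sInf_mem (s := {k : ℕ | t < ∑ i ∈ Finset.range (k + 1), s i}) hs
  refine lt_of_lt_of_le hmem (Finset.sum_le_sum_of_subset_of_nonneg ?_ fun i _ _ => (hpos i).le)
  exact Finset.range_mono (Nat.succ_le_of_lt hlt)

end Times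

/-- This separates the clock from the updates as independent factors, which permits conditioning on
the clock. -/
theorem measurePreserving_unzip {A B : Type*} [MeasurableSpace A] [MeasurableSpace B]
    (μ : Measure A) (ν : Measure B) [IsProbabilityMeasure μ] [IsProbabilityMeasure ν] :
    MeasurePreserving (fun (ω : ℕ → A × B) => ((fun i => (ω i).1), fun i => (ω i).2))
      (Measure.infinitePi fun _ : ℕ => μ.prod ν)
      ((Measure.infinitePi fun _ : ℕ => μ).prod (Measure.infinitePi fun _ : ℕ => ν)) := by
  have h : Measurable fun (ω : ℕ → A × B) => ((fun i => (ω i).1), fun i => (ω i).2) := by fun_prop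
  refine ⟨h, ?_⟩
  rw [← (measurePreserving_zip μ ν).map_eq, Measure.map_map h (measurePreserving_zip μ ν).measurable]
  exact Measure.map_id

/-! ### Iterates of the transition operator and existence of an invariant law -/

section StepOp

variable {U S : Type*} [MeasurableSpace U] [DiscreteMeasurableSpace U] [Finite U]
  [MeasurableSpace S] [DiscreteMeasurableSpace S] [Fintype S] [DecidableEq S]
  (ν : Measure U) [IsProbabilityMeasure ν] (a : U → S → S) (x : S)

omit [MeasurableSpace S] [DiscreteMeasurableSpace S] in
theorem iterate_stepOp_eq_sum (f : S → ℝ) (k : ℕ) (x : S) :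
    (stepOp ν a)^[k] f x = ∑ y, (stepOp ν a)^[k] (Pi.single y 1) x * f y := by
  induction k generalizing x with
  | zero => simp [Pi.single_apply]
  | succ k ih =>
    simp only [Function.iterate_succ_apply']
    rw [stepOp, integral_congr_ae (.of_forall fun e => ih (a e x)),
      integral_finsetSum _ fun y _ => .of_finite]
    simp only [integral_mul_const, stepOp]

omit [DecidableEq S] in
theorem iterate_stepOp_nonneg {f : S → ℝ} (hf : ∀ s, 0 ≤ f s) (k : ℕ) :
    0 ≤ (stepOp ν a)^[k] f x := by
  rw [← integral_chain]
  exact integral_nonneg fun u => hf _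

omit [DecidableEq S] in
theorem iterate_stepOp_le_one {f : S → ℝ} (hf : ∀ s, f s ≤ 1) (k : ℕ) :
    (stepOp ν a)^[k] f x ≤ 1 := by
  rw [← integral_chain]
  refine (integral_mono (integrable_chain ν a x f k) (integrable_const 1) fun u => hf _).trans ?_
  simp

omit [DecidableEq S] in
theorem real_chain_mem (B : Set S) (k : ℕ) :
    (Measure.infinitePi fun _ : ℕ => ν).real {u | chain a x u k ∈ B} =
      (stepOp ν a)^[k] (B.indicator fun _ => 1) x := by
  rw [← integral_chain, integral_indicator_chain, mul_one]

/-- A recursion whose transition operator contracts oscillations has an invariant law. -/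
theorem exists_invariant [Nonempty S] {C ρ : ℝ} (hρ : ρ < 1)
    (hosc : ∀ f : S → ℝ, (∀ s, f s ∈ Set.Icc (0 : ℝ) 1) → ∀ k x y,
      |(stepOp ν a)^[k] f y - (stepOp ν a)^[k] f x| ≤ C * ρ ^ k) :
    ∃ π : PMF S, ∀ f : S → ℝ,
      ∑ s, (π s).toReal * stepOp ν a f s = ∑ s, (π s).toReal * f s := by
  obtain ⟨x0⟩ := ‹Nonempty S›
  have hind (y s : S) : (Pi.single y 1 : S → ℝ) s ∈ Set.Icc (0 : ℝ) 1 := by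
    rw [Pi.single_apply]
    split_ifs <;> simp
  have hlim (y : S) : ∃ l, Tendsto (fun k => (stepOp ν a)^[k] (Pi.single y 1) x0) atTop (𝓝 l) := by
    -- One further step averages the `k`-th iterate over the states reachable from `x0`, so
    -- consecutive terms differ by at most its oscillation `C * ρ ^ k`. The limits do form a law,
    -- and shifting the index by one makes it invariant.
    refine cauchySeq_tendsto_of_complete (cauchySeq_of_le_geometric ρ C hρ fun k => ?_)
    rw [Function.iterate_succ_apply', Real.dist_eq, abs_sub_comm]
    set g := (stepOp ν a)^[k] (Pi.single y 1)
    have h1 : stepOp ν a g x0 - g x0 = ∫ e, (g (a e x0) - g x0) ∂ν := by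
      rw [integral_sub .of_finite (integrable_const _)]
      simp [stepOp]
    rw [h1]
    have h2 := norm_integral_le_of_norm_le_const (μ := ν) (f := fun e => g (a e x0) - g x0)
      (C := C * ρ ^ k) (.of_forall fun e => hosc _ (hind y) k x0 (a e x0))
    simpa using h2
  choose l hl using hlim
  have hsum (f : S → ℝ) : Tendsto (fun k => (stepOp ν a)^[k] f x0) atTop (𝓝 (∑ y, l y * f y)) := by
    simp only [iterate_stepOp_eq_sum ν a f]
    exact tendsto_finsetSum _ fun y _ => (hl y).mul_const _
  have hl0 (y : S) : 0 ≤ l y :=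
    ge_of_tendsto' (hl y) fun k => iterate_stepOp_nonneg ν a x0 (fun s => (hind y s).1) k
  have hl1 : ∑ y, l y = 1 := by
    have h := hsum fun _ => 1
    have h' (k : ℕ) : (stepOp ν a)^[k] (fun _ => 1) x0 = 1 := by
      rw [← integral_chain]
      simp
    simp only [h', mul_one] at h
    exact tendsto_nhds_unique h tendsto_const_nhds
  refine ⟨PMF.ofFintype (fun y => ENNReal.ofReal (l y)) ?_, fun f => ?_⟩
  · rw [← ENNReal.ofReal_sum_of_nonneg fun y _ => hl0 y, hl1, ENNReal.ofReal_one]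
  · simp only [PMF.ofFintype_apply, ENNReal.toReal_ofReal (hl0 _)]
    have h := (hsum f).comp (tendsto_add_atTop_nat 1)
    refine tendsto_nhds_unique (hsum (stepOp ν a f)) (h.congr fun k => ?_)
    simp [Function.iterate_succ_apply]

end StepOp

/-! ### From the embedded recursion to continuous time -/

section Dynamics

theorem stateAfter_eq_chain {V : Type*} [DecidableEq V] (x : State V) (ω : Randomness V) (k : ℕ) :
    stateAfter x ω k = chain Update.apply x (fun i => (ω i).2) k := by
  induction k with
  | zero => rfl
  | succ k ih => simp only [stateAfter, chain, ih]

theorem dynamics_eq_chain {V : Type*} [DecidableEq V] (x : State V) (ω : Randomness V) (t : ℝ≥0) :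
    dynamics x ω t =
      chain Update.apply x (fun i => (ω i).2) (updatesUntil t fun i => (ω i).1) := by
  rw [dynamics, stateAfter_eq_chain]
  rfl

variable {V : Type*} [Fintype V] [Nonempty V] [DecidableEq V]

section Graph

variable (G : SimpleGraph V) [DecidableRel G.Adj] (α : unitInterval)

/-- The law of the sequence of updates. -/
noncomputable abbrev updatesLaw : Measure (ℕ → Update V) :=
  Measure.infinitePi fun _ : ℕ => (updateLaw G α).toMeasure

theorem card_pos_real (V : Type*) [Fintype V] [Nonempty V] : (0 : ℝ) < Fintype.card V := by
  exact_mod_cast Fintype.card_pos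

omit [DecidableEq V] in
theorem measurePreserving_driving :
    MeasurePreserving (fun (ω : Randomness V) => ((fun i => (ω i).1), fun i => (ω i).2))
      (driving G α) ((waitingLaw (Fintype.card V)).prod (updatesLaw G α)) := by
  have := isProbabilityMeasure_expMeasure (card_pos_real V)
  exact measurePreserving_unzip _ _

instance : IsProbabilityMeasure (driving G α) := by
  have := isProbabilityMeasure_expMeasure (card_pos_real V)
  unfold driving
  infer_instance

omit [Nonempty V] in
theorem measurable_dynamics (x : State V) (t : ℝ≥0) :
    Measurable fun ω : Randomness V => dynamics x ω t := by
  have h : Measurable fun p : ℕ × (ℕ → Update V) => chain Update.apply x p.2 p.1 :=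
    measurable_from_prod_countable_right fun k => measurable_chain _ x k
  simp only [dynamics_eq_chain]
  refine h.comp (f := fun ω : Randomness V => (updatesUntil t fun i => (ω i).1, fun i => (ω i).2)) ?_
  exact ((measurable_updatesUntil t).comp (by fun_prop)).prodMk (by fun_prop)

/-- Conditionally on the clock, the configuration is the recursion at a fixed number of updates;
Fubini then averages the iterate of the transition operator over that number. -/
theorem driving_real_dynamics (x : State V) (t : ℝ≥0) (B : Set (State V)) :
    (driving G α).real {ω | dynamics x ω t ∈ B} =
      ∫ s, (stepOp (updateLaw G α).toMeasure Update.apply)^[updatesUntil t s]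
        (B.indicator fun _ => 1) x ∂(waitingLaw (Fintype.card V)) := by
  have := isProbabilityMeasure_expMeasure (card_pos_real V)
  have h : Measurable fun p : ℕ × (ℕ → Update V) => chain Update.apply x p.2 p.1 :=
    measurable_from_prod_countable_right fun k => measurable_chain _ x k
  have hm : MeasurableSet {p : (ℕ → ℝ) × (ℕ → Update V) |
      chain Update.apply x p.2 (updatesUntil t p.1) ∈ B} :=
    (h.comp (((measurable_updatesUntil t).comp measurable_fst).prodMk measurable_snd))
      (.of_discrete (s := B))
  have h1 : driving G α {ω | dynamics x ω t ∈ B} =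
      ((waitingLaw (Fintype.card V)).prod (updatesLaw G α))
        {p | chain Update.apply x p.2 (updatesUntil t p.1) ∈ B} := by
    rw [← (measurePreserving_driving G α).measure_preimage hm.nullMeasurableSet]
    simp only [dynamics_eq_chain]
    rfl
  have hmeas : Measurable fun s => (stepOp (updateLaw G α).toMeasure Update.apply)^[updatesUntil t s]
      (B.indicator fun _ => 1) x :=
    (measurable_of_countable fun k => (stepOp (updateLaw G α).toMeasure Update.apply)^[k]
      (B.indicator fun _ => 1) x).comp (measurable_updatesUntil t)
  rw [integral_eq_lintegral_of_nonneg_ae (.of_forall fun s => iterate_stepOp_nonneg _ _ _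
    (fun y => Set.indicator_nonneg (fun _ _ => zero_le_one) y) _) hmeas.aestronglyMeasurable,
    measureReal_def, h1, Measure.prod_apply hm]
  congr 1
  refine lintegral_congr fun s => ?_
  rw [← real_chain_mem, ofReal_measureReal]
  rfl

theorem isStationary_of_invariant (π : PMF (State V))
    (hπ : ∀ f : State V → ℝ, ∑ x, (π x).toReal *
      stepOp (updateLaw G α).toMeasure Update.apply f x = ∑ x, (π x).toReal * f x) :
    IsStationary G α π := by
  intro t y
  have := isProbabilityMeasure_expMeasure (card_pos_real V)
  have hfin : ∑ x, π x * driving G α {ω | dynamics x ω t = y} ≠ ∞ :=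
    ENNReal.sum_ne_top.2 fun x _ => ENNReal.mul_ne_top (π.apply_ne_top x) (measure_ne_top _ _)
  rw [← ENNReal.toReal_eq_toReal_iff' hfin (π.apply_ne_top y), ENNReal.toReal_sum fun x _ =>
    ENNReal.mul_ne_top (π.apply_ne_top x) (measure_ne_top _ _)]
  have hiter (f : State V → ℝ) (k : ℕ) : ∑ x, (π x).toReal *
      (stepOp (updateLaw G α).toMeasure Update.apply)^[k] f x = ∑ x, (π x).toReal * f x := by
    induction k with
    | zero => rfl
    | succ k ih => simp only [Function.iterate_succ_apply', hπ, ih]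
  have hd (x : State V) := driving_real_dynamics G α x t {y}
  simp only [measureReal_def, Set.mem_singleton_iff] at hd
  simp only [ENNReal.toReal_mul, hd, ← integral_const_mul]
  rw [← integral_finsetSum]
  · simp only [hiter]
    simp [Set.indicator_apply]
  · intro x _
    refine Integrable.const_mul (Integrable.of_bound (C := 1) ?_ (.of_forall fun s => ?_)) _
    · exact ((measurable_of_countable fun k => (stepOp (updateLaw G α).toMeasure Update.apply)^[k]
        (({y} : Set (State V)).indicator fun _ => 1) x).comp
        (measurable_updatesUntil t)).aestronglyMeasurable
    · rw [Real.norm_of_nonneg (iterate_stepOp_nonneg _ _ _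
        (fun y => Set.indicator_nonneg (fun _ _ => zero_le_one) y) _)]
      exact iterate_stepOp_le_one _ _ _ (fun z => Set.indicator_le_self' (by simp) z) _

theorem toMeasure_real_eq_sum {π : PMF (State V)} (hπ : IsStationary G α π) (t : ℝ≥0)
    (B : Set (State V)) :
    π.toMeasure.real B =
      ∑ x, (π x).toReal * (driving G α).real {ω | dynamics x ω t ∈ B} := by
  classical
  have h1 (x : State V) : (driving G α).real {ω | dynamics x ω t ∈ B} =
      ∑ y, if y ∈ B then (driving G α).real {ω | dynamics x ω t = y} else 0 := by
    have hm := measurable_dynamics (V := V) x t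
    have := Measure.isProbabilityMeasure_map (μ := driving G α) hm.aemeasurable
    rw [← Finset.sum_filter]
    have h2 := sum_measureReal_singleton (μ := (driving G α).map fun ω => dynamics x ω t)
      (Finset.univ.filter (· ∈ B))
    simp only [map_measureReal_apply hm (.of_discrete)] at h2
    rw [show ((Finset.univ.filter (· ∈ B) : Finset (State V)) : Set (State V)) = B by
      ext; simp] at h2
    exact h2.symm
  have h3 : π.toMeasure.real B = ∑ y, if y ∈ B then (π y).toReal else 0 := by
    rw [← Finset.sum_filter]
    have h2 := sum_measureReal_singleton (μ := π.toMeasure) (Finset.univ.filter (· ∈ B))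
    simp only [measureReal_def, PMF.toMeasure_apply_singleton _ _ (MeasurableSet.singleton _)] at h2
    rw [h2, measureReal_def]
    congr 2
    simp
  simp only [h1, h3, Finset.mul_sum]
  rw [Finset.sum_comm]
  refine Finset.sum_congr rfl fun y _ => ?_
  split_ifs
  · rw [← hπ t y, ENNReal.toReal_sum fun x _ =>
      ENNReal.mul_ne_top (π.apply_ne_top x) (measure_ne_top _ _)]
    simp [measureReal_def]
  · simp

end Graph

end Dynamics

/-! ### Mixing, hitting and non-hitting bounds in continuous time -/

section Bounds

variable {V : Type*} [Fintype V] [Nonempty V] [DecidableEq V]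
  (G : SimpleGraph V) [DecidableRel G.Adj] (α : unitInterval)

/-- The difference is at most `1` if fewer than `k` updates have occurred, which is rare by Markov's
inequality, and at most `C * ρ ^ k` otherwise. -/
theorem abs_driving_real_sub_le {ρ C : ℝ} (hρ0 : 0 ≤ ρ) (hρ : ρ ≤ 1) (hC : 0 ≤ C)
    (hosc : ∀ f : State V → ℝ, (∀ s, f s ∈ Set.Icc (0 : ℝ) 1) → ∀ k x y,
      |(stepOp (updateLaw G α).toMeasure Update.apply)^[k] f y -
        (stepOp (updateLaw G α).toMeasure Update.apply)^[k] f x| ≤ C * ρ ^ k)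
    {t : ℝ≥0} (ht : 0 < t) (k : ℕ) (x y : State V) (B : Set (State V)) :
    |(driving G α).real {ω | dynamics y ω t ∈ B} - (driving G α).real {ω | dynamics x ω t ∈ B}| ≤
      k / (Fintype.card V * t) + C * ρ ^ k := by
  have hr := card_pos_real V
  have := isProbabilityMeasure_expMeasure hr
  set T := stepOp (updateLaw G α).toMeasure Update.apply
  set f : State V → ℝ := B.indicator fun _ => 1
  have hf (s : State V) : f s ∈ Set.Icc (0 : ℝ) 1 :=
    ⟨Set.indicator_nonneg (fun _ _ => zero_le_one) s, Set.indicator_le_self' (by simp) s⟩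
  have h0 (k : ℕ) (x : State V) : 0 ≤ T^[k] f x := iterate_stepOp_nonneg _ _ _ (fun s => (hf s).1) k
  have h1 (k : ℕ) (x : State V) : T^[k] f x ≤ 1 := iterate_stepOp_le_one _ _ _ (fun s => (hf s).2) k
  have hint (x : State V) : Integrable (fun s => T^[updatesUntil t s] f x)
      (waitingLaw (Fintype.card V)) := by
    refine Integrable.of_bound (C := 1) ?_ (.of_forall fun s => ?_)
    · exact ((measurable_of_countable fun k => T^[k] f x).comp
        (measurable_updatesUntil t)).aestronglyMeasurable
    · rw [Real.norm_of_nonneg (h0 _ _)]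
      exact h1 _ _
  rw [driving_real_dynamics, driving_real_dynamics, ← integral_sub (hint y) (hint x)]
  have hms : MeasurableSet {s | updatesUntil t s < k} :=
    measurable_updatesUntil t (.of_discrete (s := Set.Iio k))
  have hpt (s : ℕ → ℝ) : |T^[updatesUntil t s] f y - T^[updatesUntil t s] f x| ≤
      {s | updatesUntil t s < k}.indicator (fun _ => (1 : ℝ)) s + C * ρ ^ k := by
    by_cases hs : updatesUntil t s < k
    · rw [Set.indicator_of_mem (by exact hs)]
      have : 0 ≤ C * ρ ^ k := mul_nonneg hC (pow_nonneg hρ0 k)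
      rw [abs_le]
      constructor <;> linarith [h0 (updatesUntil t s) x, h0 (updatesUntil t s) y,
        h1 (updatesUntil t s) x, h1 (updatesUntil t s) y]
    · rw [Set.indicator_of_notMem (by exact hs), zero_add]
      refine (hosc f hf _ x y).trans ?_
      exact mul_le_mul_of_nonneg_left (pow_le_pow_of_le_one hρ0 hρ (not_lt.1 hs)) hC
  refine (abs_integral_le_integral_abs).trans ?_
  refine (integral_mono ((hint y).sub (hint x)).abs
    (((integrable_const 1).indicator hms).add (integrable_const _)) hpt).trans ?_
  have hb := waitingLaw_updatesUntil_lt_le hr (t := t) (by exact_mod_cast ht) k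
  simp only [Pi.add_apply]
  rw [integral_add ((integrable_const 1).indicator hms) (integrable_const _),
    integral_indicator_const _ hms]
  simp only [smul_eq_mul, mul_one, integral_const, probReal_univ, one_mul]
  gcongr
  rw [measureReal_def]
  exact ENNReal.toReal_le_of_le_ofReal (by positivity) hb

/-- If the transition operator contracts oscillations, the chain mixes once the contraction factor
at a typical number of updates is small. -/
theorem mixingTime_le {ρ C : ℝ} (hρ0 : 0 ≤ ρ) (hρ : ρ < 1) (hC : 0 ≤ C)
    (hosc : ∀ f : State V → ℝ, (∀ s, f s ∈ Set.Icc (0 : ℝ) 1) → ∀ k x y,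
      |(stepOp (updateLaw G α).toMeasure Update.apply)^[k] f y -
        (stepOp (updateLaw G α).toMeasure Update.apply)^[k] f x| ≤ C * ρ ^ k)
    {t : ℝ≥0} (ht : 0 < t) (k : ℕ) (hk : k / (Fintype.card V * t) + C * ρ ^ k ≤ 1 / 4)
    {β : Type*} (f : State V → β) : mixingTime G α f ≤ t := by
  obtain ⟨π0, hπ0⟩ := exists_invariant (updateLaw G α).toMeasure Update.apply hρ hosc
  -- The choice operator returns a stationary law once one exists; uniqueness plays no part.
  have hπ : IsStationary G α (equilibrium G α) :=
    Classical.epsilon_spec (p := IsStationary G α) ⟨π0, isStationary_of_invariant G α π0 hπ0⟩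
  have : Nonempty (Set β) := ⟨∅⟩
  have : Nonempty (State V) := ⟨fun _ => true⟩
  refine iInf₂_le t ?_
  unfold distToEquilibrium
  refine ciSup_le fun x => ciSup_le fun Γ => ?_
  have hone : ∑ y, ((equilibrium G α) y).toReal = 1 := by
    rw [← ENNReal.toReal_sum fun y _ => PMF.apply_ne_top _ y, ← tsum_fintype (L := .unconditional _),
      PMF.tsum_coe, ENNReal.toReal_one]
  -- By stationarity the equilibrium is a mixture of the laws at time `t` over initial states, so
  -- comparing pairs of initial states suffices.
  rw [toMeasure_real_eq_sum G α hπ t]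
  have e : (driving G α).real {ω | f (dynamics x ω t) ∈ Γ} =
      ∑ y, ((equilibrium G α) y).toReal * (driving G α).real {ω | dynamics x ω t ∈ f ⁻¹' Γ} := by
    rw [← Finset.sum_mul, hone, one_mul]
    rfl
  rw [e, ← Finset.sum_sub_distrib]
  refine (Finset.abs_sum_le_sum_abs _ _).trans ?_
  calc _ ≤ ∑ y, ((equilibrium G α) y).toReal * (1 / 4) := by
        refine Finset.sum_le_sum fun y _ => ?_
        rw [← mul_sub, abs_mul, abs_of_nonneg ENNReal.toReal_nonneg]
        gcongr
        exact (abs_driving_real_sub_le G α hρ0 hρ.le hC hosc ht k y x _).trans hk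
    _ = 1 / 4 := by rw [← Finset.sum_mul, hone, one_mul]

theorem updatesUntil_updateTime {s : ℕ → ℝ} (hs : ∀ i, 0 < s i) (k : ℕ) :
    updatesUntil (∑ i ∈ Finset.range k, s i) s = k := by
  have hmono : StrictMono fun k => ∑ i ∈ Finset.range k, s i :=
    strictMono_nat_of_lt_succ fun k => by
      rw [Finset.sum_range_succ]
      linarith [hs k]
  have h : {j : ℕ | ∑ i ∈ Finset.range k, s i < ∑ i ∈ Finset.range (j + 1), s i} = Set.Ici k := by
    ext j
    rw [Set.mem_ofPred_eq, hmono.lt_iff_lt, Set.mem_Ici, Nat.lt_succ_iff]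
  rw [updatesUntil, h, csInf_Ici]

/-- The expected hitting time is bounded by a Lyapunov function. -/
theorem lintegral_hittingTime_le (p : ℝ) (Z : Set (State V))
    (hZ : ∀ y ∈ Z, countOnes y = ⌈p * Fintype.card V⌉₊ ∨ countOnes y = ⌊p * Fintype.card V⌋₊)
    (f : State V → ℝ) (hf : ∀ y, 0 ≤ f y)
    (hdrift : ∀ y ∉ Z, stepOp (updateLaw G α).toMeasure Update.apply f y ≤ f y - 1)
    (x : State V) :
    ∫⁻ ω, hittingTime p x ω ∂(driving G α) ≤ ENNReal.ofReal (f x / Fintype.card V) := by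
  have hr := card_pos_real V
  have := isProbabilityMeasure_expMeasure hr
  let D (k : ℕ) : Set (ℕ → Update V) := {u | chain (absorb Z Update.apply) x u k ∉ Z}
  have hD (k : ℕ) : MeasurableSet (D k) :=
    measurable_chain (absorb Z Update.apply) x k (.of_discrete (s := Zᶜ))
  have hsum : ∑' k, updatesLaw G α (D k) ≤ ENNReal.ofReal (f x) := by
    refine ENNReal.tsum_le_of_sum_range_le fun K => ?_
    have h := sum_real_chain_absorb_notMem_le (updateLaw G α).toMeasure Update.apply x Z f hf hdrift K
    calc _ = ENNReal.ofReal (∑ k ∈ Finset.range K, (updatesLaw G α).real (D k)) := by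
          rw [ENNReal.ofReal_sum_of_nonneg fun k _ => measureReal_nonneg]
          exact Finset.sum_congr rfl fun k _ => (ofReal_measureReal).symm
      _ ≤ _ := ENNReal.ofReal_le_ofReal h
  have hterm (k : ℕ) : Measurable fun q : (ℕ → ℝ) × (ℕ → Update V) =>
      ENNReal.ofReal (q.1 k) * (D k).indicator 1 q.2 :=
    ((measurable_pi_apply k).comp measurable_fst).ennreal_ofReal.mul
      ((measurable_one.indicator (hD k)).comp measurable_snd)
  have hae1 : ∀ᵐ ω ∂(driving G α), ∀ i, 0 < (ω i).1 :=
    ((measurePreserving_fst.comp (measurePreserving_driving G α)).quasiMeasurePreserving.ae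
      (ae_pos_waitingLaw hr))
  have hae2 : ∀ᵐ ω ∂(driving G α), ∀ᶠ k in atTop, (fun i => (ω i).2) ∉ D k :=
    ((measurePreserving_snd.comp (measurePreserving_driving G α)).quasiMeasurePreserving.ae
      (ae_eventually_notMem (ne_top_of_le_ne_top ENNReal.ofReal_ne_top hsum)))
  -- The hitting time is at most the sum of the waiting times that precede absorption. Whether the
  -- `k`-th one counts depends on the updates alone, hence is independent of its length, whose mean
  -- is `1/n`.
  calc ∫⁻ ω, hittingTime p x ω ∂(driving G α)
      ≤ ∫⁻ ω, (fun q : (ℕ → ℝ) × (ℕ → Update V) => ∑' k, ENNReal.ofReal (q.1 k) *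
          (D k).indicator 1 q.2) ((fun i => (ω i).1), fun i => (ω i).2) ∂(driving G α) := by
        refine lintegral_mono_ae ?_
        filter_upwards [hae1, hae2] with ω hpos hev
        set s : ℕ → ℝ := fun i => (ω i).1
        set u : ℕ → Update V := fun i => (ω i).2
        classical
        have hex : ∃ k, u ∉ D k := hev.exists
        set k0 := Nat.find hex
        have hk0 : chain (absorb Z Update.apply) x u k0 ∈ Z := not_not.1 (Nat.find_spec hex)
        have hlt : ∀ j < k0, u ∈ D j := fun j hj => not_not.1 (Nat.find_min hex hj)
        obtain ⟨j, hj, hjZ⟩ : ∃ j ≤ k0, chain Update.apply x u j ∈ Z := by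
          rcases chain_absorb_mem Z Update.apply x u k0 with h | h
          · exact h.2
          · exact absurd hk0 h.1
        have hS0 : 0 ≤ ∑ i ∈ Finset.range j, s i := Finset.sum_nonneg fun i _ => (hpos i).le
        have hdyn : dynamics x ω (∑ i ∈ Finset.range j, s i).toNNReal =
            chain Update.apply x u j := by
          rw [dynamics_eq_chain, Real.coe_toNNReal _ hS0]
          exact congrArg _ (updatesUntil_updateTime hpos j)
        calc hittingTime p x ω ≤ ENNReal.ofReal (∑ i ∈ Finset.range j, s i) :=
              iInf₂_le (∑ i ∈ Finset.range j, s i).toNNReal (by rw [hdyn]; exact hZ _ hjZ)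
          _ = ∑ i ∈ Finset.range j, ENNReal.ofReal (s i) * (D i).indicator 1 u := by
              rw [ENNReal.ofReal_sum_of_nonneg fun i _ => (hpos i).le]
              refine Finset.sum_congr rfl fun i hi => ?_
              rw [Set.indicator_of_mem (hlt i (by have := Finset.mem_range.1 hi; omega))]
              simp [s]
          _ ≤ _ := ENNReal.sum_le_tsum _
    _ = ∑' k, ∫⁻ q, ENNReal.ofReal (q.1 k) * (D k).indicator 1 q.2
          ∂((waitingLaw (Fintype.card V)).prod (updatesLaw G α)) := by
        rw [← lintegral_tsum fun k => (hterm k).aemeasurable]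
        exact (measurePreserving_driving G α).lintegral_comp (.tsum hterm)
    _ = ∑' k, ENNReal.ofReal (1 / Fintype.card V) * updatesLaw G α (D k) := by
        refine tsum_congr fun k => ?_
        rw [lintegral_prod_mul (f := fun s : ℕ → ℝ => ENNReal.ofReal (s k))
          (measurable_pi_apply k).ennreal_ofReal.aemeasurable
          (measurable_one.indicator (hD k)).aemeasurable,
          lintegral_eval_waitingLaw hr, lintegral_indicator_one (hD k)]
    _ ≤ _ := by
        rw [ENNReal.tsum_mul_left]
        refine (mul_le_mul_right hsum _).trans (le_of_eq ?_)
        rw [← ENNReal.ofReal_mul (by positivity)]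
        congr 1
        ring

/-- Either the `K`-th update has occurred by time `T` or one of the first `K` updates leads
into `Z`. -/
def earlyEntrance (Z : Set (State V)) (x : State V) (T : ℝ) (K : ℕ) : Set (Randomness V) :=
  {ω | updateTime ω K ≤ T} ∪ {ω | chain (absorb Z Update.apply) x (fun i => (ω i).2) K ∈ Z}

omit [Fintype V] [Nonempty V] in
theorem dynamics_notMem_of_notMem_earlyEntrance {Z : Set (State V)} {x : State V} {T : ℝ} {K : ℕ}
    (hK : 0 < K) {ω : Randomness V} (hω : ω ∉ earlyEntrance Z x T K) {t : ℝ≥0} (ht : t ≤ T) :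
    dynamics x ω t ∉ Z := by
  simp only [earlyEntrance, Set.mem_union, Set.mem_ofPred_eq, not_or, not_le] at hω
  obtain ⟨h1, h2⟩ := hω
  rw [dynamics_eq_chain]
  -- The `K`-th update comes after `T`, so at most `K - 1` have occurred by time `t`; this is where
  -- `K > 0` matters.
  have hN : updatesUntil t (fun i => (ω i).1) ≤ K - 1 := by
    refine Nat.sInf_le ?_
    rw [Set.mem_ofPred_eq, Nat.sub_add_cancel hK]
    exact lt_of_le_of_lt ht h1
  rcases chain_absorb_mem Z Update.apply x (fun i => (ω i).2) K with h | h
  · exact absurd h.1 h2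
  · exact h.2.2 _ (by omega)

omit [Nonempty V] in
theorem measurableSet_earlyEntrance (Z : Set (State V)) (x : State V) (T : ℝ) (K : ℕ) :
    MeasurableSet (earlyEntrance Z x T K) := by
  have h1 : Measurable fun ω : Randomness V => updateTime ω K := by
    unfold updateTime
    fun_prop
  have h2 : Measurable fun ω : Randomness V => fun i => (ω i).2 := by fun_prop
  exact (measurableSet_le h1 measurable_const).union
    (((measurable_chain (absorb Z Update.apply) x K).comp h2) (.of_discrete (s := Z)))

theorem driving_real_earlyEntrance_le (Z : Set (State V)) (x : State V) {T : ℝ} (hT : 0 < T)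
    {K : ℕ} (hK : 0 < K) :
    (driving G α).real (earlyEntrance Z x T K) ≤ Real.exp 1 * Fintype.card V * T / K +
      (updatesLaw G α).real {u | chain (absorb Z Update.apply) x u K ∈ Z} := by
  have hr := card_pos_real V
  have := isProbabilityMeasure_expMeasure hr
  refine (measureReal_union_le _ _).trans (add_le_add ?_ (le_of_eq ?_))
  · have h := (measurePreserving_fst.comp (measurePreserving_driving G α)).measure_preimage
      (s := {s | ∑ i ∈ Finset.range K, s i ≤ T})
      (measurableSet_le (by fun_prop) measurable_const).nullMeasurableSet
    rw [measureReal_def]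
    refine ENNReal.toReal_le_of_le_ofReal (by positivity) ?_
    exact h.le.trans (waitingLaw_sum_le_le hr hT hK)
  · exact (measurePreserving_snd.comp (measurePreserving_driving G α)).measureReal_preimage
      (s := {u | chain (absorb Z Update.apply) x u K ∈ Z})
      ((measurable_chain (absorb Z Update.apply) x K (.of_discrete (s := Z)))).nullMeasurableSet

end Bounds

/-! ### Noise above the threshold: logarithmic hitting and mixing times -/

theorem eventually_pnat {P : ℕ+ → Prop} (h : ∀ᶠ m : ℕ in atTop, ∀ n : ℕ+, (n : ℕ) = m → P n) :
    ∀ᶠ n in atTop, P n :=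
  (tendsto_PNat_val_atTop_atTop.eventually h).mono fun n hn => hn n rfl

/-- Two terms of the logarithm series. The quadratic one is what captures the fluctuations near
balance. -/
theorem log_one_sub_le {u : ℝ} (h0 : 0 ≤ u) (h1 : u < 1) : Real.log (1 - u) ≤ -u - u ^ 2 / 2 := by
  have h := sum_le_hasSum (Finset.range 2) (fun i _ => by positivity)
    (Real.hasSum_pow_div_log_of_abs_lt_one (x := u) (by rwa [abs_of_nonneg h0]))
  norm_num [Finset.sum_range_succ] at h
  linarith

theorem upProb_nonneg {α n h : ℝ} (hα : 0 ≤ α) (hα1 : α ≤ 1) (hn : 0 < n) (hh : h ≤ n) :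
    0 ≤ upProb α n h := by
  have h1 : 0 ≤ 1 - α := by linarith
  have h2 : 0 ≤ n - h := by linarith
  unfold upProb
  positivity

/-- The last factor decides between restoring and repelling drift; all dependence on the threshold
`1/3` in the birth-death estimates comes from it. -/
theorem upProb_sub_upProb {α n h : ℝ} (hn : 1 < n) :
    upProb α n (n - h) - upProb α n h =
      (2 * h - n) / n * (α / 2 - (1 - α) * (h * (n - h)) / (n - 1) ^ 2) := by
  have h1 : n - 1 ≠ 0 := by linarith
  have h2 : n ≠ 0 := by linarith
  unfold upProb
  field_simp
  ring

/-- A Lyapunov function for the distance of the number of ones to `n / 2`. -/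
noncomputable def lyapunov (n h : ℝ) : ℝ := Real.log (1 + |2 * h - n| / √n)

theorem lyapunov_nonneg (n h : ℝ) : 0 ≤ lyapunov n h :=
  Real.log_nonneg (le_add_of_nonneg_right (by positivity))

theorem lyapunov_sub (n h : ℝ) : lyapunov n (n - h) = lyapunov n h := by
  unfold lyapunov
  rw [← abs_neg]
  ring_nf

/-- With `d = 2h - n` and `u = 2/(√n + d)`, a step changes the logarithm by `log (1 ± u)`, so the
drift is at most `-(q-p)u - q u^2/2` for up- and down-probabilities `p` and `q`. The scale `√n` is
where the two terms balance. -/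
theorem lyapunov_drift_le {α n h : ℝ} (hα : 1 / 3 < α) (hα1 : α ≤ 1) (hn : 4 ≤ n * (3 * α - 1))
    (hd : 2 ≤ 2 * h - n) (hh : h ≤ n) :
    upProb α n h * (lyapunov n (h + 1) - lyapunov n h) +
      upProb α n (n - h) * (lyapunov n (h - 1) - lyapunov n h) ≤ -((3 * α - 1) / 16) / n := by
  have hn2 : 2 ≤ n := by nlinarith
  have hn0 : 0 < n := by linarith
  set s := √n with hs
  have hs0 : 0 < s := Real.sqrt_pos.2 hn0
  have hss : s ^ 2 = n := Real.sq_sqrt hn0.le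
  set d := 2 * h - n with hdd
  set u := 2 / (s + d) with hu
  have hsd : 0 < s + d := by linarith
  have hu0 : 0 < u := by positivity
  have hu1 : u < 1 := by
    rw [hu, div_lt_one hsd]
    linarith
  have hL0 : lyapunov n h = Real.log ((s + d) / s) := by
    rw [lyapunov, ← hs, ← hdd, abs_of_nonneg (by linarith)]
    congr 1
    field_simp
  have hL1 : lyapunov n (h + 1) - lyapunov n h ≤ u := by
    have e : lyapunov n (h + 1) = Real.log ((s + d) / s) + Real.log (1 + u) := by
      rw [← Real.log_mul (by positivity) (by positivity), lyapunov, ← hs,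
        show 2 * (h + 1) - n = d + 2 by rw [hdd]; ring, abs_of_nonneg (by linarith)]
      congr 1
      rw [hu]
      field_simp
      ring
    rw [e, hL0]
    linarith [Real.log_le_sub_one_of_pos (show 0 < 1 + u by linarith)]
  have hL2 : lyapunov n (h - 1) - lyapunov n h ≤ -u - u ^ 2 / 2 := by
    have e : lyapunov n (h - 1) = Real.log ((s + d) / s) + Real.log (1 - u) := by
      rw [← Real.log_mul (by positivity) (by linarith), lyapunov, ← hs,
        show 2 * (h - 1) - n = d - 2 by rw [hdd]; ring, abs_of_nonneg (by linarith)]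
      congr 1
      rw [hu]
      field_simp
      ring
    rw [e, hL0]
    linarith [log_one_sub_le hu0.le hu1]
  have hp := upProb_nonneg (α := α) (by linarith) hα1 hn0 hh
  have hq := upProb_nonneg (α := α) (n := n) (h := n - h) (by linarith) hα1 hn0 (by linarith)
  have hdiff : (3 * α - 1) / 8 * (d / n) ≤ upProb α n (n - h) - upProb α n h := by
    rw [upProb_sub_upProb (by linarith), mul_comm]
    refine mul_le_mul_of_nonneg_left ?_ (div_nonneg (by linarith) hn0.le)
    -- The bound `(1+α)/8` is midway between the limiting value `(1-α)/4` and `α/2`; the lower bound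
    -- on `n` absorbs the replacement of `n` by `n - 1`.
    have h1 : (1 - α) * (h * (n - h)) / (n - 1) ^ 2 ≤ (1 + α) / 8 := by
      rw [div_le_iff₀ (by nlinarith)]
      have h2 : h * (n - h) ≤ n ^ 2 / 4 := by nlinarith [sq_nonneg (2 * h - n)]
      have h3 : (1 - α) * (h * (n - h)) ≤ (1 - α) * (n ^ 2 / 4) :=
        mul_le_mul_of_nonneg_left h2 (by linarith)
      nlinarith
    linarith
  have hlow : α / 4 ≤ upProb α n (n - h) := by
    have h1 : 1 / 2 ≤ (n - (n - h)) / n := by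
      rw [le_div_iff₀ hn0]
      linarith
    have h2 : α / 2 ≤ α / 2 + (1 - α) * ((n - h) / (n - 1)) ^ 2 := by
      have : 0 ≤ 1 - α := by linarith
      have : 0 ≤ (1 - α) * ((n - h) / (n - 1)) ^ 2 := by positivity
      linarith
    unfold upProb
    calc α / 4 = 1 / 2 * (α / 2) := by ring
      _ ≤ _ := mul_le_mul h1 h2 (by linarith) (by linarith)
  have hmain : upProb α n h * (lyapunov n (h + 1) - lyapunov n h) +
      upProb α n (n - h) * (lyapunov n (h - 1) - lyapunov n h) ≤
      -((3 * α - 1) / 8 * (d / n) * u + α / 4 * (u ^ 2 / 2)) := by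
    have a1 := mul_le_mul_of_nonneg_left hL1 hp
    have a2 := mul_le_mul_of_nonneg_left hL2 hq
    have a3 := mul_le_mul_of_nonneg_right hdiff hu0.le
    have a4 := mul_le_mul_of_nonneg_right hlow (show 0 ≤ u ^ 2 / 2 by positivity)
    nlinarith
  refine hmain.trans ?_
  rw [neg_div, neg_le_neg_iff]
  have hc : 0 < 3 * α - 1 := by linarith
  -- For `d ≥ √n` the restoring drift suffices, since `d * u ≥ 1`; for `d ≤ √n` the quadratic term
  -- does, since `u^2 ≥ 1/n`.
  rcases le_total s d with hsd' | hsd'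
  · have h1 : 1 ≤ d * u := by
      rw [hu, mul_div_assoc', le_div_iff₀ hsd]
      linarith
    have h2 : (3 * α - 1) / 8 * (d / n) * u = (3 * α - 1) / 8 / n * (d * u) := by
      field_simp
    have h3 : (3 * α - 1) / 8 / n * 1 ≤ (3 * α - 1) / 8 / n * (d * u) :=
      mul_le_mul_of_nonneg_left h1 (by positivity)
    have h4 : (3 * α - 1) / 16 / n ≤ (3 * α - 1) / 8 / n * 1 := by
      rw [mul_one]
      gcongr
      norm_num
    have h5 : 0 ≤ α / 4 * (u ^ 2 / 2) := by positivity
    linarith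
  · have h1 : 1 / n ≤ u ^ 2 := by
      rw [hu, div_pow, div_le_div_iff₀ hn0 (by positivity)]
      nlinarith
    have h2 : α / 8 * (1 / n) ≤ α / 8 * u ^ 2 := mul_le_mul_of_nonneg_left h1 (by linarith)
    have h3 : (3 * α - 1) / 16 / n ≤ α / 8 * (1 / n) := by
      rw [mul_one_div]
      gcongr ?_ / n
      linarith
    have h5 : 0 ≤ (3 * α - 1) / 8 * (d / n) * u := by
      have : 0 ≤ d := by linarith
      positivity
    linarith

section FastMixing

variable (α : unitInterval)

theorem expected_hittingTime_le (hα : 1 / 3 < (α : ℝ)) {V : Type*} [Fintype V] [DecidableEq V]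
    [Nonempty V] [DecidableRel (⊤ : SimpleGraph V).Adj]
    (hn : 4 ≤ (Fintype.card V : ℝ) * (3 * α - 1)) (x : State V) :
    ∫⁻ ω, hittingTime (1 / 2) x ω ∂(driving (⊤ : SimpleGraph V) α) ≤
      ENNReal.ofReal (16 / (3 * α - 1) * lyapunov (Fintype.card V) (count true x)) := by
  have hα1 : (α : ℝ) ≤ 1 := α.2.2
  have hc : 0 < 3 * (α : ℝ) - 1 := by linarith
  set n : ℝ := ((Fintype.card V : ℕ) : ℝ) with hnd
  have hn2 : 2 ≤ n := by nlinarith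
  have hV : 2 ≤ Fintype.card V := by rw [hnd] at hn2; exact_mod_cast hn2
  set A : ℝ := 16 / (3 * α - 1) * n with hA
  have hA0 : 0 < A := by positivity
  have h := lintegral_hittingTime_le (⊤ : SimpleGraph V) α (1 / 2)
    {y | countOnes y = ⌈1 / 2 * n⌉₊ ∨ countOnes y = ⌊1 / 2 * n⌋₊} (fun y hy => hy)
    (fun y => A * lyapunov n (count true y)) (fun y => mul_nonneg hA0.le (lyapunov_nonneg _ _))
    (fun y hy => ?_) x
  · refine h.trans (le_of_eq ?_)
    congr 1
    rw [hA, ← hnd]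
    field_simp
  · have hadd : (count true y : ℝ) + count false y = n := by
      rw [hnd]
      exact_mod_cast count_add_count true y
    -- Outside the target the count is at least one beyond the floor or the ceiling of `n/2`; hence
    -- a single step cannot cross the balanced point.
    have hfar : (2 : ℝ) ≤ |2 * (count true y : ℝ) - n| := by
      rw [Set.mem_ofPred_eq, not_or] at hy
      have hy' : count true y ≠ ⌈1 / 2 * n⌉₊ ∧ count true y ≠ ⌊1 / 2 * n⌋₊ := hy
      have h1 := Nat.ceil_le_floor_add_one (1 / 2 * n)
      have h2 : (⌊1 / 2 * n⌋₊ : ℝ) ≤ 1 / 2 * n := Nat.floor_le (by positivity)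
      have h3 : 1 / 2 * n ≤ (⌈1 / 2 * n⌉₊ : ℝ) := Nat.le_ceil _
      rcases lt_or_ge (count true y) ⌊1 / 2 * n⌋₊ with h4 | h4
      · have h5 : (count true y : ℝ) + 1 ≤ (⌊1 / 2 * n⌋₊ : ℝ) := by exact_mod_cast h4
        rw [abs_sub_comm]
        exact le_trans (by linarith) (le_abs_self _)
      · have h6 : ⌈1 / 2 * n⌉₊ + 1 ≤ count true y := by omega
        have h5 : (⌈1 / 2 * n⌉₊ : ℝ) + 1 ≤ (count true y : ℝ) := by exact_mod_cast h6
        exact le_trans (by linarith) (le_abs_self _)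
    -- The function is symmetric in the two opinions, so the drift may be computed for the majority
    -- opinion.
    have hcol (c : Bool) : (fun y : State V => A * lyapunov n (count true y)) =
        fun y => A * lyapunov n (count c y) := by
      funext y
      cases c
      · have : (count true y : ℝ) + count false y = n := by
          rw [hnd]
          exact_mod_cast count_add_count true y
        rw [← lyapunov_sub, ← this, add_sub_cancel_left]
      · rfl
    obtain ⟨c, hcd, hcn⟩ : ∃ c : Bool, (2 : ℝ) ≤ 2 * count c y - n ∧ (count c y : ℝ) ≤ n := by
      rcases le_abs.1 hfar with h1 | h1
      · exact ⟨true, h1, by linarith [(count false y).cast_nonneg (α := ℝ)]⟩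
      · exact ⟨false, by linarith, by linarith [(count true y).cast_nonneg (α := ℝ)]⟩
    have hstep := transOp_count α hV c (fun h => A * lyapunov n h) y
    rw [transOp, ← hcol c] at hstep
    rw [hstep, congrFun (hcol c) y, ← hnd]
    have hdr := lyapunov_drift_le hα hα1 hn hcd hcn
    have h2 : A * (-((3 * α - 1) / 16) / n) = -1 := by
      rw [hA]
      field_simp
    have h3 := mul_le_mul_of_nonneg_left hdr hA0.le
    rw [h2] at h3
    linarith

theorem expected_hittingTime_isBigO_log (hα : 1 / 3 < (α : ℝ)) :
    ∃ C > (0 : ℝ), ∀ᶠ n : ℕ+ in atTop, ∀ x : State (Fin n),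
        ∫⁻ ω, hittingTime (1 / 2) x ω ∂(driving (K n) α) ≤
          ENNReal.ofReal (C * Real.log n) := by
  have hc : 0 < 3 * (α : ℝ) - 1 := by linarith
  refine ⟨16 / (3 * α - 1), by positivity, eventually_pnat ?_⟩
  filter_upwards [eventually_ge_atTop 4, tendsto_natCast_atTop_atTop.eventually_ge_atTop
    (4 / (3 * (α : ℝ) - 1))] with m hm4 hm n hnm x
  subst hnm
  have hcard : Fintype.card (Fin n) = n := Fintype.card_fin n
  rw [div_le_iff₀ hc] at hm
  refine (expected_hittingTime_le α hα (by rwa [hcard]) x).trans (ENNReal.ofReal_le_ofReal ?_)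
  have hn4 : (4 : ℝ) ≤ (n : ℕ) := by exact_mod_cast hm4
  gcongr
  rw [lyapunov, hcard]
  refine Real.log_le_log (by positivity) ?_
  have hle : (count true x : ℝ) ≤ (n : ℕ) := by
    have := count_add_count true x
    rw [hcard] at this
    exact_mod_cast (by omega : count true x ≤ (n : ℕ))
  have habs : |2 * (count true x : ℝ) - (n : ℕ)| ≤ (n : ℕ) := by
    rw [abs_le]
    constructor <;> linarith [(count true x).cast_nonneg (α := ℝ)]
  have hs2 : (2 : ℝ) ≤ √((n : ℕ) : ℝ) := Real.le_sqrt_of_sq_le (by linarith)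
  have hss : √((n : ℕ) : ℝ) ^ 2 = (n : ℕ) := Real.sq_sqrt (by linarith)
  have h1 : |2 * (count true x : ℝ) - (n : ℕ)| / √((n : ℕ) : ℝ) ≤ √((n : ℕ) : ℝ) := by
    rw [div_le_iff₀ (by linarith)]
    nlinarith
  nlinarith

theorem mixingTime_isBigO_log (hα : 1 / 3 < (α : ℝ)) :
    ∃ C > (0 : ℝ), ∀ᶠ n : ℕ+ in atTop, ∀ (β : Type) (f : State (Fin n) → β),
      mixingTime (K n) α f ≤ ENNReal.ofReal (C * Real.log n) := by
  have hα1 : (α : ℝ) ≤ 1 := α.2.2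
  have hc : 0 < 3 * (α : ℝ) - 1 := by linarith
  -- Half of the limiting contraction rate `(3α-1)/2`; the other half absorbs the correction
  -- `(1-α)/(n-1)` for large `n`.
  set c : ℝ := (3 * α - 1) / 4 with hcd
  have hc0 : 0 < c := by positivity
  refine ⟨16 / c + 8, by positivity, eventually_pnat ?_⟩
  filter_upwards [eventually_ge_atTop 8, tendsto_natCast_atTop_atTop.eventually_ge_atTop
    (1 + 4 / (3 * (α : ℝ) - 1))] with m hm8 hm n hnm β f
  subst hnm
  have hcard : Fintype.card (Fin n) = n := Fintype.card_fin n
  obtain ⟨N, hN⟩ : ∃ N : ℝ, N = ((n : ℕ) : ℝ) := ⟨_, rfl⟩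
  have hN8 : 8 ≤ N := by rw [hN]; exact_mod_cast hm8
  have hN0 : 0 < N := by linarith
  rw [← hN] at hm ⊢
  have hV : 2 ≤ Fintype.card (Fin n) := by omega
  have hNc : ((Fintype.card (Fin n) : ℕ) : ℝ) = N := by rw [hcard, hN]
  have hcn : (1 - (α : ℝ)) / (N - 1) ≤ c := by
    rw [div_le_iff₀ (by linarith)]
    have : 4 / (3 * (α : ℝ) - 1) ≤ N - 1 := by linarith
    rw [div_le_iff₀ hc] at this
    rw [hcd]
    linarith
  have hcn0 : 0 ≤ (1 - (α : ℝ)) / (N - 1) := div_nonneg (by linarith) (by linarith)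
  have hρle : contraction α N ≤ 1 - c / N := by
    unfold contraction
    gcongr
    linarith
  have hρ0 : 0 ≤ contraction α N := by
    unfold contraction
    rw [sub_nonneg, div_le_one hN0]
    linarith
  have hρ1 : contraction α N < 1 := by
    have : 0 < c / N := by positivity
    linarith
  have hlog : 1 ≤ Real.log N := by
    rw [Real.le_log_iff_exp_le hN0]
    linarith [Real.exp_one_lt_d9]
  -- After this many updates the contraction is at most `N^(-2)`, which leaves `1/N ≤ 1/8`. The time
  -- `8k/N` makes the clock error `1/8` as well, for a total of `1/4`.
  set k : ℕ := ⌈2 / c * N * Real.log N⌉₊ with hk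
  have hk1 : 2 / c * N * Real.log N ≤ k := Nat.le_ceil _
  have hk2 : (k : ℝ) < 2 / c * N * Real.log N + 1 := Nat.ceil_lt_add_one (by positivity)
  have hk0 : (0 : ℝ) < k := lt_of_lt_of_le (by positivity) hk1
  have ht : 0 < (8 * k / N).toNNReal := Real.toNNReal_pos.2 (by positivity)
  have hpow : N * contraction α N ^ k ≤ 1 / 8 := by
    have h1 : contraction α N ≤ Real.exp (-(c / N)) := by
      linarith [Real.add_one_le_exp (-(c / N))]
    have h2 : contraction α N ^ k ≤ Real.exp (-(2 * Real.log N)) := by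
      refine (pow_le_pow_left₀ hρ0 h1 k).trans ?_
      rw [← Real.exp_nat_mul, Real.exp_le_exp, mul_neg, neg_le_neg_iff]
      have h3 := mul_le_mul_of_nonneg_right hk1 (show 0 ≤ c / N by positivity)
      have h4 : 2 / c * N * Real.log N * (c / N) = 2 * Real.log N := by
        field_simp
      linarith
    have h3 : Real.exp (-(2 * Real.log N)) = (N ^ 2)⁻¹ := by
      rw [Real.exp_neg, mul_comm, Real.exp_mul, Real.exp_log hN0, Real.rpow_two]
    rw [h3] at h2
    calc N * contraction α N ^ k ≤ N * (N ^ 2)⁻¹ := mul_le_mul_of_nonneg_left h2 hN0.le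
      _ = 1 / N := by field_simp
      _ ≤ 1 / 8 := by gcongr
  have hosc := abs_iterate_transOp_sub_le (V := Fin n) α hV
  rw [hNc] at hosc
  refine (mixingTime_le (K n) α (ρ := contraction α N) (C := N) hρ0 hρ1 hN0.le
    (fun f hf k x y => hosc f hρ0 hf k x y) ht k ?_ f).trans ?_
  · rw [hNc, Real.coe_toNNReal _ (by positivity)]
    have : (k : ℝ) / (N * (8 * k / N)) = 1 / 8 := by
      field_simp
    linarith
  · refine ENNReal.ofReal_le_ofReal ?_
    rw [div_le_iff₀ hN0]
    have e : 8 * (2 / c * N * Real.log N + 1) = 16 / c * Real.log N * N + 8 := by ring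
    have e2 : 1 ≤ Real.log N * N := by nlinarith
    nlinarith

end FastMixing

/-! ### Noise below the threshold: the exponential barrier -/

theorem upProb_le_one {α n h : ℝ} (hα : 0 ≤ α) (hα1 : α ≤ 1) (hn : 1 < n) (hh0 : 0 ≤ h)
    (hh : h ≤ n - 1) : upProb α n h ≤ 1 := by
  have h1 : (h / (n - 1)) ^ 2 ≤ 1 :=
    pow_le_one₀ (div_nonneg hh0 (by linarith)) ((div_le_one (by linarith)).2 hh)
  have h2 : (n - h) / n ≤ 1 := (div_le_one (by linarith)).2 (by linarith)
  have h3 : (1 - α) * (h / (n - 1)) ^ 2 ≤ (1 - α) * 1 :=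
    mul_le_mul_of_nonneg_left h1 (by linarith)
  have h4 : 0 ≤ (1 - α) * (h / (n - 1)) ^ 2 := mul_nonneg (by linarith) (sq_nonneg _)
  exact mul_le_one₀ h2 (by linarith) (by linarith)

/-- Below `(1 / 2 - δ) n` the exponential function `exp (θ (h - (1 / 2 - 2 δ) n))` has a drift that
is bounded independently of `n`. -/
theorem exp_drift_le {α δ n h : ℝ} (hα : 0 ≤ α) (hδ : 0 < δ)
    (hδα : δ ≤ (1 - 3 * α) / 8) (hn : 4 ≤ n) (hh0 : 0 ≤ h) (hh : h < (1 / 2 - δ) * n) {θ : ℝ}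
    (hθ : 0 < θ) (hθδ : Real.exp (-θ) = 1 - δ * (1 - 3 * α) / 4) :
    upProb α n h * (Real.exp (θ * (h + 1 - (1 / 2 - 2 * δ) * n)) -
        Real.exp (θ * (h - (1 / 2 - 2 * δ) * n))) +
      upProb α n (n - h) * (Real.exp (θ * (h - 1 - (1 / 2 - 2 * δ) * n)) -
        Real.exp (θ * (h - (1 / 2 - 2 * δ) * n))) ≤ Real.exp θ - 1 := by
  have hn0 : 0 < n := by linarith
  have hhn : h ≤ n / 2 := by nlinarith
  have hp := upProb_nonneg (α := α) hα (by linarith) hn0 (show h ≤ n by linarith)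
  have hq := upProb_nonneg (α := α) (n := n) (h := n - h) hα (by linarith) hn0 (by linarith)
  set E := Real.exp (θ * (h - (1 / 2 - 2 * δ) * n)) with hE
  have hE0 : 0 < E := Real.exp_pos _
  have e1 : Real.exp (θ * (h + 1 - (1 / 2 - 2 * δ) * n)) = E * Real.exp θ := by
    rw [hE, ← Real.exp_add]
    ring_nf
  have e2 : Real.exp (θ * (h - 1 - (1 / 2 - 2 * δ) * n)) = E * Real.exp (-θ) := by
    rw [hE, ← Real.exp_add]
    ring_nf
  have hθ1 : 1 < Real.exp θ := Real.one_lt_exp_iff.2 hθ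
  have hθ2 : Real.exp (-θ) < 1 := Real.exp_zero ▸ Real.exp_lt_exp.2 (by linarith)
  rw [e1, e2]
  -- Below the band the exponential is at most `1`, so an upward step adds at most `exp θ - 1` on
  -- average. Inside the band the function is a supermartingale.
  rcases lt_or_ge h ((1 / 2 - 2 * δ) * n) with hlow | hband
  · have hE1 : E ≤ 1 := Real.exp_le_one_iff.2 (mul_nonpos_of_nonneg_of_nonpos hθ.le (by linarith))
    have hp1 := upProb_le_one (α := α) hα (by linarith) (show 1 < n by linarith) hh0 (by linarith)
    have h1 : upProb α n h * E * (Real.exp θ - 1) ≤ 1 * (Real.exp θ - 1) :=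
      mul_le_mul_of_nonneg_right (mul_le_one₀ hp1 hE0.le hE1) (by linarith)
    have h2 : 0 ≤ upProb α n (n - h) * E * (1 - Real.exp (-θ)) :=
      mul_nonneg (mul_nonneg hq hE0.le) (by linarith)
    linarith
  · have hδ8 : δ ≤ 1 / 8 := by linarith
    have hh1 : 1 ≤ h := by nlinarith
    have hq1 := upProb_le_one (α := α) (h := n - h) hα (by linarith) (show 1 < n by linarith)
      (by linarith) (by linarith)
    have hdiff : δ * (1 - 3 * α) / 4 ≤ upProb α n (n - h) - upProb α n h := by
      rw [upProb_sub_upProb (by linarith)]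
      have h1 : 2 * δ ≤ (n - 2 * h) / n := by
        rw [le_div_iff₀ hn0]
        nlinarith
      have h2 : (1 - 3 * α) / 8 ≤ (1 - α) * (h * (n - h)) / (n - 1) ^ 2 - α / 2 := by
        have h3 : (1 / 4 - 4 * δ ^ 2) * n ^ 2 ≤ h * (n - h) := by
          nlinarith
        have h4 : (1 - α) * (1 / 4 - 4 * δ ^ 2) ≤ (1 - α) * (h * (n - h)) / (n - 1) ^ 2 := by
          rw [le_div_iff₀ (by nlinarith), mul_assoc]
          refine mul_le_mul_of_nonneg_left (le_trans ?_ h3) (by linarith)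
          refine mul_le_mul_of_nonneg_left ?_ (by nlinarith)
          nlinarith
        have h5 : 4 * δ ^ 2 ≤ (1 - 3 * α) / 16 := by nlinarith
        have h6 : (1 - α) * (4 * δ ^ 2) ≤ 1 * (4 * δ ^ 2) :=
          mul_le_mul_of_nonneg_right (by linarith) (by positivity)
        linarith
      have h7 := mul_le_mul h1 h2 (by linarith) (by linarith)
      calc δ * (1 - 3 * α) / 4 = 2 * δ * ((1 - 3 * α) / 8) := by ring
        _ ≤ _ := h7
        _ = _ := by ring
    have hη0 : 0 ≤ δ * (1 - 3 * α) / 4 := by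
      have : 0 ≤ 1 - 3 * α := by linarith
      positivity
    -- With `η = δ(1-3α)/4` and down-probability `q ≤ 1`, the gap is at least `η`, hence at least `q
    -- * η`, and `1 - η = exp (-θ)`.
    have hkey : upProb α n h ≤ upProb α n (n - h) * Real.exp (-θ) := by
      have h10 := mul_nonneg (sub_nonneg.2 hq1) hη0
      rw [hθδ]
      linarith
    have h8 : upProb α n h * (E * Real.exp θ - E) + upProb α n (n - h) * (E * Real.exp (-θ) - E) =
        E * (Real.exp θ - 1) * (upProb α n h - upProb α n (n - h) * Real.exp (-θ)) := by
      have : Real.exp θ * Real.exp (-θ) = 1 := by rw [← Real.exp_add]; simp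
      linear_combination (E * upProb α n (n - h)) * this
    rw [h8]
    have h9 : E * (Real.exp θ - 1) * (upProb α n h - upProb α n (n - h) * Real.exp (-θ)) ≤ 0 :=
      mul_nonpos_of_nonneg_of_nonpos (mul_nonneg hE0.le (by linarith)) (by linarith)
    linarith

section Metastability

variable (α : unitInterval)

/-- Starting from at most `(1 / 2 - 2 δ) n` nodes with opinion `c`, the number of such nodes stays
below `(1 / 2 - δ) n` for an exponentially long time. -/
theorem exists_earlyEntrance_le (hα : (α : ℝ) < 1 / 3) {δ : ℝ} (hδ : 0 < δ)
    (hδα : δ ≤ (1 - 3 * α) / 8) :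
    ∃ κ > (0 : ℝ), ∃ ε : ℕ → ℝ, Tendsto ε atTop (𝓝 0) ∧ ∀ n : ℕ+, 4 ≤ (n : ℕ) → ∀ (c : Bool)
      (x : State (Fin n)), (count c x : ℝ) ≤ (1 / 2 - 2 * δ) * (n : ℕ) → ∃ k > 0,
        (driving (K n) α).real (earlyEntrance {y | (1 / 2 - δ) * (n : ℕ) ≤ count c y} x
          (Real.exp (κ * (n : ℕ))) k) ≤ ε n := by
  have hα0 : (0 : ℝ) ≤ α := α.2.1
  have hη0 : 0 < δ * (1 - 3 * α) / 4 := by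
    have : 0 < 1 - 3 * (α : ℝ) := by linarith
    positivity
  have hη1 : δ * (1 - 3 * α) / 4 < 1 := by nlinarith
  set θ : ℝ := -Real.log (1 - δ * (1 - 3 * α) / 4) with hθ
  have hθ0 : 0 < θ := by
    rw [hθ, neg_pos]
    exact Real.log_neg (by linarith) (by linarith)
  have hθδ : Real.exp (-θ) = 1 - δ * (1 - 3 * α) / 4 := by
    rw [hθ, neg_neg, Real.exp_log (by linarith)]
  set q := θ * δ with hq
  have hq0 : 0 < q := by positivity
  set a := Real.exp θ - 1 with ha
  have ha0 : 0 < a := by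
    rw [ha, sub_pos]
    exact Real.one_lt_exp_iff.2 hθ0
  -- The barrier has height `exp (q n)`. Allowing `exp (q n / 2)` updates makes crossing unlikely,
  -- and time `exp (q n / 4)` makes it unlikely that so many updates occur.
  refine ⟨q / 4, by positivity, fun m => Real.exp 1 * (m * Real.exp (-(q / 4 * m))) +
    (1 + 2 * a) * Real.exp (-(q / 2 * m)), ?_, ?_⟩
  · have h1 : Tendsto (fun m : ℕ => (m : ℝ) * Real.exp (-(q / 4 * m))) atTop (𝓝 0) := by
      have h := (tendsto_rpow_mul_exp_neg_mul_atTop_nhds_zero 1 (q / 4) (by positivity)).comp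
        (tendsto_natCast_atTop_atTop (R := ℝ))
      simpa [Function.comp_def] using h
    have h2 : Tendsto (fun m : ℕ => Real.exp (-(q / 2 * m))) atTop (𝓝 0) :=
      Real.tendsto_exp_neg_atTop_nhds_zero.comp
        (tendsto_natCast_atTop_atTop.const_mul_atTop (by positivity))
    simpa using (h1.const_mul (Real.exp 1)).add (h2.const_mul (1 + 2 * a))
  intro n hn4 c x hx
  have hcard : Fintype.card (Fin n) = n := Fintype.card_fin n
  obtain ⟨N, hN⟩ : ∃ N : ℝ, N = ((n : ℕ) : ℝ) := ⟨_, rfl⟩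
  rw [← hN] at hx
  have hN4 : 4 ≤ N := by rw [hN]; exact_mod_cast hn4
  have hNc : ((Fintype.card (Fin n) : ℕ) : ℝ) = N := by rw [hcard, hN]
  have hV : 2 ≤ Fintype.card (Fin n) := by omega
  set B := Real.exp (q / 2 * N) with hB
  have hB1 : 1 ≤ B := Real.one_le_exp (by positivity)
  have hk1 : B ≤ ⌈B⌉₊ := Nat.le_ceil _
  have hk2 : (⌈B⌉₊ : ℝ) < B + 1 := Nat.ceil_lt_add_one (by linarith)
  have hk0 : 0 < ⌈B⌉₊ := Nat.ceil_pos.2 (by linarith)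
  refine ⟨⌈B⌉₊, hk0, ?_⟩
  beta_reduce
  rw [← hN]
  refine (driving_real_earlyEntrance_le (K n) α _ x (Real.exp_pos _) hk0).trans ?_
  rw [hNc]
  refine add_le_add ?_ ?_
  · calc Real.exp 1 * N * Real.exp (q / 4 * N) / ⌈B⌉₊ ≤
          Real.exp 1 * N * Real.exp (q / 4 * N) / B := by gcongr
      _ = Real.exp 1 * (N * Real.exp (-(q / 4 * N))) := by
        rw [hB, mul_div_assoc, ← Real.exp_sub, mul_assoc]
        ring_nf
  · have h := real_chain_absorb_mem_le (updateLaw (K n) α).toMeasure Update.apply x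
      {y | (1 / 2 - δ) * N ≤ count c y}
      (fun y => Real.exp (θ * (count c y - (1 / 2 - 2 * δ) * N))) (fun y => (Real.exp_pos _).le)
      ha0.le (M := Real.exp (q * N)) (fun y hy => ?_) (fun y hy => ?_) ⌈B⌉₊
    · have hx1 : Real.exp (θ * (count c x - (1 / 2 - 2 * δ) * N)) ≤ 1 :=
        Real.exp_le_one_iff.2 (mul_nonpos_of_nonneg_of_nonpos hθ0.le (by linarith))
      have h3 : Real.exp (q * N) = B * B := by
        rw [hB, ← Real.exp_add]
        ring_nf
      have h4 : Real.exp (-(q / 2 * N)) = B⁻¹ := by rw [hB, Real.exp_neg]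
      rw [h3] at h
      have h5 : (⌈B⌉₊ : ℝ) * a ≤ (2 * B) * a := mul_le_mul_of_nonneg_right (by linarith) ha0.le
      rw [h4, ← div_eq_mul_inv, le_div_iff₀ (by linarith)]
      have h6 : (updatesLaw (K n) α).real {u | chain (absorb {y | (1 / 2 - δ) * N ≤ count c y}
          Update.apply) x u ⌈B⌉₊ ∈ {y | (1 / 2 - δ) * N ≤ count c y}} * B * B ≤
          (1 + 2 * a) * B := by
        rw [mul_assoc]
        linarith
      exact le_of_mul_le_mul_right h6 (by linarith)
    · rw [Set.mem_ofPred_eq, not_le] at hy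
      have hstep := transOp_count (V := Fin n) α hV c
        (fun h => Real.exp (θ * (h - (1 / 2 - 2 * δ) * N))) y
      rw [transOp] at hstep
      rw [hstep, hNc, add_assoc]
      exact add_le_add le_rfl (exp_drift_le hα0 hδ hδα hN4 (by positivity) hy hθ0 hθδ)
    · rw [Set.mem_ofPred_eq] at hy
      refine Real.exp_le_exp.2 ?_
      rw [hq, mul_assoc]
      exact mul_le_mul_of_nonneg_left (by linarith) hθ0.le

/-- If both laws were within `1/4` of one distribution, they would differ by at most `1/2` on `Γ`,
against a gap of `1 - 2ε`. Of the equilibrium only the fact that it is a probability law is needed.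
-/
theorem le_mixingTime {V : Type*} [Fintype V] [Nonempty V] [DecidableEq V] (G : SimpleGraph V)
    [DecidableRel G.Adj] {β : Type*} (f : State V → β) (Γ : Set β) (x y : State V) {T ε : ℝ}
    (hε : ε < 1 / 4)
    (hx : ∀ t : ℝ≥0, t ≤ T → (driving G α).real {ω | f (dynamics x ω t) ∈ Γ} ≤ ε)
    (hy : ∀ t : ℝ≥0, t ≤ T → 1 - ε ≤ (driving G α).real {ω | f (dynamics y ω t) ∈ Γ}) :
    ENNReal.ofReal T ≤ mixingTime G α f := by
  refine le_iInf₂ fun t ht => ?_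
  by_contra! hlt
  have htT : (t : ℝ) ≤ T := by
    rw [ENNReal.lt_ofReal_iff_toReal_lt ENNReal.coe_ne_top] at hlt
    exact hlt.le
  have hd (z : State V) : |(driving G α).real {ω | f (dynamics z ω t) ∈ Γ} -
      (equilibrium G α).toMeasure.real (f ⁻¹' Γ)| ≤ 1 / 4 := by
    refine le_trans ?_ ht
    unfold distToEquilibrium
    refine le_trans ?_ (le_ciSup (Set.finite_range _).bddAbove z)
    refine le_ciSup (f := fun Γ : Set β => |(driving G α).real {ω | f (dynamics z ω t) ∈ Γ} -
      (equilibrium G α).toMeasure.real (f ⁻¹' Γ)|) ⟨1, ?_⟩ Γ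
    rintro _ ⟨Γ', rfl⟩
    have h1 := measureReal_le_one (μ := driving G α) (s := {ω | f (dynamics z ω t) ∈ Γ'})
    have h2 := measureReal_le_one (μ := (equilibrium G α).toMeasure) (s := f ⁻¹' Γ')
    have h3 := measureReal_nonneg (μ := driving G α) (s := {ω | f (dynamics z ω t) ∈ Γ'})
    have h4 := measureReal_nonneg (μ := (equilibrium G α).toMeasure) (s := f ⁻¹' Γ')
    exact abs_le.2 ⟨by linarith, by linarith⟩
  have h1 := abs_le.1 (hd x)
  have h2 := abs_le.1 (hd y)
  linarith [hx t htT, hy t htT]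

theorem count_eq_of_const {V : Type*} [Fintype V] {c b : Bool} (h : b ≠ c) :
    count c (fun _ : V => b) = 0 := by
  simp [count, h]

/-- Any observable that determines the count separates the two consensus starts, which treats `X`
and `A` together. From all zeros the ones stay below the barrier; from all ones the zeros do, so the
ones stay above it. -/
theorem exp_le_mixingTime (hα : (α : ℝ) < 1 / 3) :
    ∃ κ > (0 : ℝ), ∃ C > (0 : ℝ), ∀ᶠ n : ℕ+ in atTop,
      ∀ (β : Type) (f : State (Fin n) → β),
        (∃ g : β → ℕ, ∀ y, g (f y) = countOnes y) →
        ENNReal.ofReal (C * Real.exp (κ * n)) ≤ mixingTime (K n) α f := by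
  have hα0 : (0 : ℝ) ≤ α := α.2.1
  set δ : ℝ := (1 - 3 * α) / 8 with hδ
  have hδ0 : 0 < δ := by
    rw [hδ]
    linarith
  have hδ8 : δ ≤ 1 / 8 := by
    rw [hδ]
    linarith
  obtain ⟨κ, hκ, ε, hε, H⟩ := exists_earlyEntrance_le α hα hδ0 le_rfl
  refine ⟨κ, hκ, 1, one_pos, eventually_pnat ?_⟩
  filter_upwards [eventually_ge_atTop 4, hε.eventually_lt_const (show (0 : ℝ) < 1 / 4 by norm_num)]
    with m hm4 hεm n hnm β f ⟨g, hg⟩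
  subst hnm
  have hcard : Fintype.card (Fin n) = n := Fintype.card_fin n
  obtain ⟨N, hN⟩ : ∃ N : ℝ, N = ((n : ℕ) : ℝ) := ⟨_, rfl⟩
  have hN4 : 4 ≤ N := by rw [hN]; exact_mod_cast hm4
  have hstart (c : Bool) : (count c (fun _ : Fin n => !c) : ℝ) ≤ (1 / 2 - 2 * δ) * (n : ℕ) := by
    rw [count_eq_of_const (by cases c <;> simp), ← hN]
    push_cast
    nlinarith
  obtain ⟨k, hk, h1⟩ := H n hm4 true _ (hstart true)
  obtain ⟨l, hl, h2⟩ := H n hm4 false _ (hstart false)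
  rw [one_mul]
  refine le_mixingTime α (K n) f {b | (1 / 2 - δ) * (n : ℕ) ≤ g b} (fun _ => !true)
    (fun _ => !false) hεm (fun t ht => ?_) (fun t ht => ?_)
  · refine le_trans (measureReal_mono fun ω hω => ?_) h1
    by_contra hω'
    refine dynamics_notMem_of_notMem_earlyEntrance hk hω' ht ?_
    rw [Set.mem_ofPred_eq, Set.mem_ofPred_eq, hg] at hω
    exact hω
  · refine le_trans ?_ (measureReal_mono (s₁ := (earlyEntrance
      {y | (1 / 2 - δ) * (n : ℕ) ≤ count false y} (fun _ => !false)
      (Real.exp (κ * (n : ℕ))) l)ᶜ) fun ω hω => ?_)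
    · rw [probReal_compl_eq_one_sub (measurableSet_earlyEntrance _ _ _ _)]
      linarith
    · have h3 := dynamics_notMem_of_notMem_earlyEntrance hl hω ht
      rw [Set.mem_ofPred_eq, not_le] at h3
      rw [Set.mem_ofPred_eq, Set.mem_ofPred_eq, hg]
      have h4 : (count true (dynamics (fun _ => !false) ω t) : ℝ) +
          count false (dynamics (fun _ => !false) ω t) = (n : ℕ) := by
        have := count_add_count true (dynamics (fun _ => !false) ω t)
        rw [hcard] at this
        exact_mod_cast this
      change (1 / 2 - δ) * (n : ℕ) ≤ (count true (dynamics (fun _ => !false) ω t) : ℝ)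
      rw [← hN] at h3 h4 ⊢
      nlinarith

theorem tendsto_exp_le_hittingTime (hα : (α : ℝ) < 1 / 3) {p : ℝ} (hp : p ∈ Set.Icc (0 : ℝ) 1)
    (hp2 : p ≠ 1 / 2) : ∃ κ > (0 : ℝ), ∃ C > (0 : ℝ),
        ∀ x : (n : ℕ+) → State (Fin n), (∀ n, countOnes (x n) = ⌈(n : ℝ) * p⌉₊) →
          Tendsto (fun n : ℕ+ => driving (K n) α
            {ω | ENNReal.ofReal (C * Real.exp (κ * n)) ≤ hittingTime (1 / 2) (x n) ω})
            atTop (𝓝 1) := by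
  have hα0 : (0 : ℝ) ≤ α := α.2.1
  have hg0 : 0 < |p - 1 / 2| := abs_pos.2 (sub_ne_zero.2 hp2)
  -- The minority opinion starts with at most about `(1/2 - 4δ)n` nodes. This leaves room for
  -- rounding below `(1/2 - 2δ)n` once `δ n ≥ 1`.
  set δ : ℝ := min (|p - 1 / 2| / 4) ((1 - 3 * α) / 8) with hδ
  have hδ0 : 0 < δ := lt_min (by positivity) (by linarith)
  have hδ1 : δ ≤ |p - 1 / 2| / 4 := min_le_left _ _
  obtain ⟨κ, hκ, ε, hε, H⟩ := exists_earlyEntrance_le α hα hδ0 (min_le_right _ _)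
  refine ⟨κ, hκ, 1, one_pos, fun x hx => ?_⟩
  have hlim : Tendsto (fun n : ℕ+ => ENNReal.ofReal (1 - ε n)) atTop (𝓝 1) := by
    have h1 := (hε.comp tendsto_PNat_val_atTop_atTop).const_sub 1
    rw [sub_zero] at h1
    rw [← ENNReal.ofReal_one]
    exact ENNReal.tendsto_ofReal h1
  refine tendsto_of_tendsto_of_tendsto_of_le_of_le' hlim tendsto_const_nhds (eventually_pnat ?_)
    (.of_forall fun n => prob_le_one)
  filter_upwards [eventually_ge_atTop 4,
    tendsto_natCast_atTop_atTop.eventually_ge_atTop (1 / δ)] with m hm4 hm n hnm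
  subst hnm
  have hcard : Fintype.card (Fin n) = n := Fintype.card_fin n
  obtain ⟨N, hN⟩ : ∃ N : ℝ, N = ((n : ℕ) : ℝ) := ⟨_, rfl⟩
  have hN4 : 4 ≤ N := by rw [hN]; exact_mod_cast hm4
  rw [div_le_iff₀ hδ0, ← hN] at hm
  have hadd (y : State (Fin n)) : (count true y : ℝ) + count false y = N := by
    rw [hN]
    have := count_add_count true y
    rw [hcard] at this
    exact_mod_cast this
  have hx' : (count true (x n) : ℝ) = ⌈N * p⌉₊ := by
    rw [hN]
    exact_mod_cast hx n
  have hc1 : N * p ≤ ⌈N * p⌉₊ := Nat.le_ceil _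
  have hc2 : (⌈N * p⌉₊ : ℝ) < N * p + 1 :=
    Nat.ceil_lt_add_one (mul_nonneg (by linarith) hp.1)
  obtain ⟨c, hc⟩ : ∃ c : Bool, (count c (x n) : ℝ) ≤ (1 / 2 - 2 * δ) * N := by
    rcases lt_or_gt_of_ne hp2 with h | h
    · refine ⟨true, ?_⟩
      rw [abs_of_neg (by linarith)] at hδ1
      nlinarith
    · refine ⟨false, ?_⟩
      rw [abs_of_pos (by linarith)] at hδ1
      have := hadd (x n)
      nlinarith
  obtain ⟨k, hk, h1⟩ := H n hm4 c (x n) (by rw [← hN]; exact hc)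
  set E := earlyEntrance {y | (1 / 2 - δ) * (n : ℕ) ≤ count c y} (x n)
    (Real.exp (κ * (n : ℕ))) k
  have hE : ENNReal.ofReal (1 - ε n) ≤ driving (K n) α Eᶜ := by
    rw [← ofReal_measureReal, probReal_compl_eq_one_sub (measurableSet_earlyEntrance _ _ _ _)]
    exact ENNReal.ofReal_le_ofReal (by linarith)
  refine hE.trans (measure_mono fun ω hω => ?_)
  rw [Set.mem_ofPred_eq, one_mul]
  refine le_iInf₂ fun t ht => ?_
  by_contra! hlt
  have htT : (t : ℝ) ≤ Real.exp (κ * (n : ℕ)) := by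
    rw [ENNReal.lt_ofReal_iff_toReal_lt ENNReal.coe_ne_top] at hlt
    exact hlt.le
  refine dynamics_notMem_of_notMem_earlyEntrance hk hω htT ?_
  rw [Set.mem_ofPred_eq, ← hN]
  rw [hcard, ← hN] at ht
  -- At a hitting time both counts are within `1` of `N/2`, hence at least `(1/2 - δ)N`: whichever
  -- opinion was the minority has crossed its barrier.
  have h2 : N / 2 - 1 ≤ (count true (dynamics (x n) ω t) : ℝ) ∧
      (count true (dynamics (x n) ω t) : ℝ) ≤ N / 2 + 1 := by
    have hh : 0 ≤ 1 / 2 * N := by linarith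
    rcases ht with h | h
    · have h3 : (count true (dynamics (x n) ω t) : ℝ) = ⌈1 / 2 * N⌉₊ := by exact_mod_cast h
      rw [h3]
      constructor <;> linarith [Nat.le_ceil (1 / 2 * N), Nat.ceil_lt_add_one hh]
    · have h3 : (count true (dynamics (x n) ω t) : ℝ) = ⌊1 / 2 * N⌋₊ := by exact_mod_cast h
      rw [h3]
      constructor <;> linarith [Nat.floor_le hh, Nat.lt_floor_add_one (1 / 2 * N)]
  have h3 := hadd (dynamics (x n) ω t)
  cases c
  · linarith [h2.2]
  · linarith [h2.1]

end Metastability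

end TwoChoices

open TwoChoices
theorem theorem1 (α : unitInterval) :
    (0 < (α : ℝ) → (α : ℝ) < 1 / 3 →
      -- the mixing times of `X` and of `A`
      (∃ κ > (0 : ℝ), ∃ C > (0 : ℝ), ∀ᶠ n : ℕ+ in atTop,
        ENNReal.ofReal (C * Real.exp (κ * n)) ≤ mixingTime (K n) α id ∧
        ENNReal.ofReal (C * Real.exp (κ * n)) ≤ mixingTime (K n) α countOnes) ∧
      -- the hitting time
      (∀ p ∈ Set.Icc (0 : ℝ) 1, p ≠ 1 / 2 → ∃ κ > (0 : ℝ), ∃ C > (0 : ℝ),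
        ∀ x : (n : ℕ+) → State (Fin n), (∀ n, countOnes (x n) = ⌈(n : ℝ) * p⌉₊) →
          Tendsto (fun n : ℕ+ => driving (K n) α
            {ω | ENNReal.ofReal (C * Real.exp (κ * n)) ≤ hittingTime (1 / 2) (x n) ω})
            atTop (𝓝 1))) ∧
    (1 / 3 < (α : ℝ) →
      -- the mixing times of `X` and of `A`
      (∃ C > (0 : ℝ), ∀ᶠ n : ℕ+ in atTop,
        mixingTime (K n) α id ≤ ENNReal.ofReal (C * Real.log n) ∧
        mixingTime (K n) α countOnes ≤ ENNReal.ofReal (C * Real.log n)) ∧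
      -- the expected hitting time, uniformly over the initial configuration
      (∃ C > (0 : ℝ), ∀ᶠ n : ℕ+ in atTop, ∀ x : State (Fin n),
        ∫⁻ ω, hittingTime (1 / 2) x ω ∂(driving (K n) α) ≤
          ENNReal.ofReal (C * Real.log n))) := by
  refine ⟨fun _ hα => ⟨?_, fun p hp hp2 => tendsto_exp_le_hittingTime α hα hp hp2⟩,
    fun hα => ⟨?_, expected_hittingTime_isBigO_log α hα⟩⟩
  · obtain ⟨κ, hκ, C, hC, h⟩ := exp_le_mixingTime α hα
    exact ⟨κ, hκ, C, hC, h.mono fun n hn =>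
      ⟨hn _ id ⟨countOnes, fun _ => rfl⟩, hn _ countOnes ⟨id, fun _ => rfl⟩⟩⟩
  · obtain ⟨C, hC, h⟩ := mixingTime_isBigO_log α hα
    exact ⟨C, hC, h.mono fun n hn => ⟨hn _ id, hn _ countOnes⟩⟩
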